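/- Let $I\subseteq\mathbb R$ be a nonempty open interval. A weight matrix of size $N$ on $I$ is a smooth function $W:I\to \mathrm{Mat}_N(\mathbb C)$ that is positive definite almost everywhere and has finite moments of all orders; $\{P_n\}_{n\ge 0}$ denotes its sequence of monic orthogonal matrix polynomials for $\langle P,Q\rangle_W=\int_I P(x)W(x)Q(x)^*\,dx$. Let $\mathrm{Mat}_N(\Omega[x])$ be the algebra of differential operators $D=\sum_{i=0}^m\partial^iF_i(x)$ with $F_i\in\mathrm{Mat}_N(\mathbb C[x])$, acting on the right by $P\cdot D=\sum_i P^{(i)}F_i$, and let $$\mathcal D(W)=\{D\in \mathrm{Mat}_N(\Omega[x]) : \text{for every } n\ge 0 \text{ there is } \Lambda_n\in\mathrm{Mat}_N(\mathbb C) \text{ with } P_n\cdot D=\Lambda_nP_n\},$$ with center $\mathcal Z(W)$. An operator $\mathcal V\in\mathrm{Mat}_N(\Omega[x])$ is degree-preserving if $\deg(P\cdot\mathcal V)=\deg P$ for every matrix polynomial $P$ (with $\deg 0=-\infty$). For weight matrices $W,W'$ of size $N$ on $I$ with monic orthogonal polynomials $P_n,P_n'$, we say that $W'$ is a Darboux transformation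 of $W$ obtained by factoring $D\in\mathcal D(W)$ if $D=\mathcal V\mathcal N$ with degree-preserving $\mathcal V,\mathcal N\in\mathrm{Mat}_N(\Omega[x])$ such that for every $n\ge0$ there is $A_n\in\mathrm{Mat}_N(\mathbb C)$ with $P_n\cdot\mathcal V=A_nP_n'$. Darboux equivalence is the equivalence relation generated by Darboux transformations on the weight matrices of size $N$ on $I$. The classical scalar weights are the (shifted) Hermite weights $e^{-x^2+2bx}$ on $(-\infty,\infty)$ ($b\in\mathbb R$), the Laguerre weights $e^{-x}x^\alpha$ on $(0,\infty)$ ($\alpha>-1$), and the Jacobi weights $(1-x)^\alpha(1+x)^\beta$ on $(-1,1)$ ($\alpha,\beta>-1$). **Theorem.** Let $w_1,\dots,w_N$ be classical scalar weights of the same type (all Hermite, all Laguerre or all Jacobi), let $\widetilde W=w_1\oplus\cdots\oplus w_N=\operatorname{diag}(w_1,\dots,w_N)$, and let $W$ be a weight matrix of size $N$ on the same interval that is Darboux-equivalent to $\widetilde W$. Then there is $D\in\mathcal Z(\widetilde W)$ such that $W$ is a Darboux transformation of $\widetilde W$ obtained by factoring $D$. -/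

import Mathlib

open Polynomial MeasureTheory
open scoped ContDiff Matrix ComplexOrder

noncomputable section

namespace MatrixBochner

/-- Complex `N × N` matrices. -/
abbrev Mat (N : ℕ) := Matrix (Fin N) (Fin N) ℂ

/-- Matrix polynomials: polynomials in `x` with coefficients in `Mat N`. -/
abbrev MatPoly (N : ℕ) := (Mat N)[X]

/-- The value of a matrix polynomial at a real point. -/
def evalReal {N : ℕ} (P : MatPoly N) (x : ℝ) : Mat N :=
  P.eval (algebraMap ℂ (Mat N) (x : ℂ))

/-! ### Matrix differential operators acting on the right -/

/-- Operators acting on the right of matrix polynomials and commuting with left multiplication by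
constant matrices. The opposite ring makes the product `D * E` mean "first `D`, then `E`". -/
abbrev RightOp (N : ℕ) := (Module.End (Mat N) (MatPoly N))ᵐᵒᵖ

/-- The right action `P · D`. -/
def act {N : ℕ} (P : MatPoly N) (D : RightOp N) : MatPoly N := D.unop P

/-- The differential operator `∑_{i ≤ m} ∂^i F_i(x)`, with
`P · D = ∑_{i ≤ m} P^{(i)}(x) F_i(x)`. -/
def diffOp {N : ℕ} (m : ℕ) (F : ℕ → MatPoly N) : RightOp N :=
  MulOpposite.op
    { toFun := fun P => ∑ i ∈ Finset.range (m + 1), derivative^[i] P * F i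
      map_add' := by
        intro P Q
        simp [iterate_map_add, add_mul, Finset.sum_add_distrib]
      map_smul' := by
        intro A P
        simp [Polynomial.iterate_derivative_smul, Finset.smul_sum, smul_mul_assoc] }

lemma act_diffOp {N : ℕ} (m : ℕ) (F : ℕ → MatPoly N) (P : MatPoly N) :
    act P (diffOp m F) = ∑ i ∈ Finset.range (m + 1), derivative^[i] P * F i := rfl

lemma act_mul {N : ℕ} (P : MatPoly N) (D E : RightOp N) : act P (D * E) = act (act P D) E := rfl

lemma act_add {N : ℕ} (P : MatPoly N) (D E : RightOp N) :
    act P (D + E) = act P D + act P E := rfl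

lemma act_smul {N : ℕ} (A : Mat N) (P : MatPoly N) (D : RightOp N) :
    act (A • P) D = A • act P D := D.unop.map_smul A P

lemma rightOp_ext {N : ℕ} {D E : RightOp N} (h : ∀ P, act P D = act P E) : D = E :=
  MulOpposite.unop_injective (LinearMap.ext h)

/-- The underlying set of the algebra of matrix differential operators with polynomial
coefficients. -/
def IsDiffOp {N : ℕ} (D : RightOp N) : Prop := ∃ m F, D = diffOp m F

lemma IsDiffOp.add {N : ℕ} {D E : RightOp N} (hD : IsDiffOp D) (hE : IsDiffOp E) :
    IsDiffOp (D + E) := by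
  obtain ⟨m, F, rfl⟩ := hD
  obtain ⟨k, G, rfl⟩ := hE
  refine ⟨m + k, fun i => (if i < m + 1 then F i else 0) + (if i < k + 1 then G i else 0),
    rightOp_ext fun P => ?_⟩
  simp only [act_add, act_diffOp, mul_add, mul_ite, mul_zero, Finset.sum_add_distrib]
  congr 1 <;>
  · rw [← Finset.sum_filter]
    refine Finset.sum_congr ?_ fun _ _ => rfl
    ext i
    simp only [Finset.mem_range, Finset.mem_filter]
    omega

lemma IsDiffOp.zero {N : ℕ} : IsDiffOp (0 : RightOp N) :=
  ⟨0, 0, rightOp_ext fun P => by simp only [act_diffOp]; simp [act]⟩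

lemma IsDiffOp.sum {N : ℕ} (s : Finset ℕ) (D : ℕ → RightOp N) (h : ∀ i, IsDiffOp (D i)) :
    IsDiffOp (∑ i ∈ s, D i) := by
  classical
  induction s using Finset.induction_on with
  | empty => simpa using IsDiffOp.zero
  | insert a s ha ih => rw [Finset.sum_insert ha]; exact (h a).add ih

lemma act_sum {N : ℕ} (P : MatPoly N) (s : Finset ℕ) (D : ℕ → RightOp N) :
    act P (∑ i ∈ s, D i) = ∑ i ∈ s, act P (D i) := by
  classical
  induction s using Finset.induction_on with
  | empty => simp [act]
  | insert a s ha ih => rw [Finset.sum_insert ha, Finset.sum_insert ha, act_add, ih]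

/-- The monomial operator `∂^i F`. -/
def monoOp {N : ℕ} (i : ℕ) (F : MatPoly N) : RightOp N := diffOp i (fun j => if j = i then F else 0)

lemma act_monoOp {N : ℕ} (i : ℕ) (F P : MatPoly N) :
    act P (monoOp i F) = derivative^[i] P * F := by
  simp [monoOp, act_diffOp]

lemma isDiffOp_monoOp {N : ℕ} (i : ℕ) (F : MatPoly N) : IsDiffOp (monoOp i F) := ⟨_, _, rfl⟩

lemma diffOp_eq_sum {N : ℕ} (m : ℕ) (F : ℕ → MatPoly N) :
    diffOp m F = ∑ i ∈ Finset.range (m + 1), monoOp i (F i) :=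
  rightOp_ext fun P => by simp [act_sum, act_monoOp, act_diffOp]

lemma IsDiffOp.mul_monoOp_zero {N : ℕ} {D : RightOp N} (hD : IsDiffOp D) (G : MatPoly N) :
    IsDiffOp (D * monoOp 0 G) := by
  obtain ⟨m, F, rfl⟩ := hD
  refine ⟨m, fun i => F i * G, rightOp_ext fun P => ?_⟩
  rw [act_mul, act_monoOp, act_diffOp, act_diffOp, Function.iterate_zero, id, Finset.sum_mul]
  exact Finset.sum_congr rfl fun i _ => mul_assoc _ _ _

lemma IsDiffOp.mul_monoOp_one {N : ℕ} {D : RightOp N} (hD : IsDiffOp D) :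
    IsDiffOp (D * monoOp 1 1) := by
  obtain ⟨m, F, rfl⟩ := hD
  have : diffOp m F * monoOp 1 1 = ∑ i ∈ Finset.range (m + 1),
      (monoOp (i + 1) (F i) + monoOp i (derivative (F i))) := by
    refine rightOp_ext fun P => ?_
    rw [act_mul, act_monoOp, act_diffOp, act_sum, mul_one, Function.iterate_one, derivative_sum]
    refine Finset.sum_congr rfl fun i _ => ?_
    rw [derivative_mul, act_add, act_monoOp, act_monoOp, Function.iterate_succ_apply']
  rw [this]
  exact IsDiffOp.sum _ _ fun i => (isDiffOp_monoOp _ _).add (isDiffOp_monoOp _ _)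

lemma monoOp_succ {N : ℕ} (j : ℕ) (G : MatPoly N) :
    monoOp (j + 1) G = monoOp 1 1 * monoOp j G := by
  refine rightOp_ext fun P => ?_
  rw [act_mul, act_monoOp, act_monoOp, act_monoOp, mul_one, Function.iterate_one,
    Function.iterate_succ_apply]

lemma IsDiffOp.mul_monoOp {N : ℕ} {D : RightOp N} (hD : IsDiffOp D) (j : ℕ) (G : MatPoly N) :
    IsDiffOp (D * monoOp j G) := by
  induction j generalizing D with
  | zero => exact hD.mul_monoOp_zero G
  | succ j ih =>
    rw [monoOp_succ, ← mul_assoc]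
    exact ih hD.mul_monoOp_one

lemma IsDiffOp.mul {N : ℕ} {D E : RightOp N} (hD : IsDiffOp D) (hE : IsDiffOp E) :
    IsDiffOp (D * E) := by
  obtain ⟨m, F, rfl⟩ := hE
  rw [diffOp_eq_sum, Finset.mul_sum]
  exact IsDiffOp.sum _ _ fun i => hD.mul_monoOp i (F i)

/-- The algebra of all operators `∑_{i ≤ m} ∂^i F_i(x)` with matrix polynomial coefficients. -/
def matDiffOps (N : ℕ) : Subalgebra ℂ (RightOp N) where
  carrier := {D | IsDiffOp D}
  mul_mem' := IsDiffOp.mul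
  add_mem' := IsDiffOp.add
  algebraMap_mem' := by
    intro r
    refine ⟨0, fun _ => C (algebraMap ℂ (Mat N) r), rightOp_ext fun P => ?_⟩
    rw [act_diffOp]
    simp only [zero_add, Finset.range_one, Finset.sum_singleton, Function.iterate_zero, id]
    change r • P = _
    ext n : 1
    rw [coeff_mul_C, coeff_smul, Algebra.smul_def, Algebra.commutes]

/-- `V` is degree-preserving: `deg (P · V) = deg P` for every matrix polynomial `P`
(the zero polynomial has degree `⊥`). -/
def IsDegreePreserving {N : ℕ} (V : RightOp N) : Prop :=
  ∀ P : MatPoly N, (act P V).degree = P.degree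

/-! ### Weight matrices -/

/-- A weight matrix of size `N` on the nonempty open interval `I` of the real line. Only the
values on `I` matter. -/
structure WeightMatrix (N : ℕ) (I : Set ℝ) where
  toFun : ℝ → Mat N
  isOpen : IsOpen I
  ordConnected : I.OrdConnected
  nonempty : I.Nonempty
  smooth : ∀ i j, ContDiffOn ℝ ∞ (fun x => toFun x i j) I
  posDef : ∀ᵐ x ∂(volume.restrict I), (toFun x).PosDef
  moments : ∀ (n : ℕ) (i j : Fin N), IntegrableOn (fun x : ℝ => (x : ℂ) ^ n * toFun x i j) I

namespace WeightMatrix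

variable {N : ℕ} {I : Set ℝ}

/-- The matrix-valued form `⟨P, Q⟩_W = ∫_I P(x) W(x) Q(x)^* dx`. -/
def form (W : WeightMatrix N I) (P Q : MatPoly N) : Mat N :=
  Matrix.of fun i j => ∫ x in I, (evalReal P x * W.toFun x * (evalReal Q x)ᴴ) i j

lemma evalReal_add (P Q : MatPoly N) (x : ℝ) :
    evalReal (P + Q) x = evalReal P x + evalReal Q x := by simp [evalReal]

lemma evalReal_monomial (k : ℕ) (A : Mat N) (x : ℝ) :
    evalReal (monomial k A) x = ((x : ℂ) ^ k) • A := by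
  rw [evalReal, eval_monomial, ← map_pow, ← Algebra.commutes, Algebra.smul_def]

lemma evalReal_smul (A : Mat N) (P : MatPoly N) (x : ℝ) :
    evalReal (A • P) x = A * evalReal P x := by simp [evalReal]

lemma integrable_form (W : WeightMatrix N I) (P Q : MatPoly N) (i j : Fin N) :
    IntegrableOn (fun x => (evalReal P x * W.toFun x * (evalReal Q x)ᴴ) i j) I := by
  induction P using Polynomial.induction_on' with
  | add P P' hP hP' =>
    simp only [evalReal_add, add_mul, Matrix.add_apply]
    exact hP.add hP'
  | monomial k A =>
    induction Q using Polynomial.induction_on' with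
    | add Q Q' hQ hQ' =>
      simp only [evalReal_add, mul_add, Matrix.add_apply, Matrix.conjTranspose_add]
      exact hQ.add hQ'
    | monomial l B =>
      have : (fun x : ℝ => (evalReal (monomial k A) x * W.toFun x *
            (evalReal (monomial l B) x)ᴴ) i j) =
          fun x : ℝ => ∑ b, ∑ a, (A i a * star (B j b)) * ((x : ℂ) ^ (k + l) * W.toFun x a b) := by
        funext x
        simp only [evalReal_monomial, Matrix.mul_apply, Matrix.conjTranspose_apply,
          Matrix.smul_apply, smul_eq_mul, Finset.sum_mul]
        refine Finset.sum_congr rfl fun b _ => Finset.sum_congr rfl fun a _ => ?_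
        simp only [star_mul', star_pow, Complex.star_def, Complex.conj_ofReal]
        ring
      rw [this]
      exact integrable_finsetSum _ fun b _ => integrable_finsetSum _ fun a _ =>
        (W.moments (k + l) a b).const_mul _

lemma form_add_left (W : WeightMatrix N I) (P P' Q : MatPoly N) :
    W.form (P + P') Q = W.form P Q + W.form P' Q := by
  ext i j
  simp only [form, Matrix.of_apply, Matrix.add_apply, evalReal_add, add_mul]
  exact integral_add (W.integrable_form P Q i j) (W.integrable_form P' Q i j)

lemma form_smul_left (W : WeightMatrix N I) (A : Mat N) (P Q : MatPoly N) :
    W.form (A • P) Q = A * W.form P Q := by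
  ext i j
  simp only [form, Matrix.of_apply, evalReal_smul, mul_assoc]
  simp only [Matrix.mul_apply (M := A), Matrix.of_apply, ← mul_assoc]
  rw [integral_finsetSum _ fun k _ => (W.integrable_form P Q k j).const_mul _]
  exact Finset.sum_congr rfl fun k _ => integral_const_mul _ _

lemma form_conj (W : WeightMatrix N I) (P Q : MatPoly N) :
    (W.form P Q)ᴴ = W.form Q P := by
  ext i j
  simp only [form, Matrix.of_apply, Matrix.conjTranspose_apply]
  rw [Complex.star_def, ← integral_conj]
  refine integral_congr_ae ?_
  filter_upwards [W.posDef] with x hx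
  rw [← Complex.star_def, ← Matrix.conjTranspose_apply]
  simp only [Matrix.conjTranspose_mul, Matrix.conjTranspose_conjTranspose, hx.1.eq, mul_assoc]

lemma form_zero_left (W : WeightMatrix N I) (Q : MatPoly N) : W.form 0 Q = 0 := by
  have := W.form_smul_left 0 0 Q
  simpa using this

lemma form_sum_left (W : WeightMatrix N I) {ι : Type*} (s : Finset ι) (P : ι → MatPoly N)
    (Q : MatPoly N) : W.form (∑ k ∈ s, P k) Q = ∑ k ∈ s, W.form (P k) Q := by
  classical
  induction s using Finset.induction_on with
  | empty => simp [form_zero_left]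
  | insert a s ha ih => rw [Finset.sum_insert ha, Finset.sum_insert ha, form_add_left, ih]

lemma eq_zero_of_form_self (W : WeightMatrix N I) (Q : MatPoly N) (h : W.form Q Q = 0) :
    Q = 0 := by
  have key : ∀ i, ∀ᵐ x ∂(volume.restrict I), ∀ k, evalReal Q x i k = 0 := by
    intro i
    have hexp : ∀ x, (evalReal Q x * W.toFun x * (evalReal Q x)ᴴ) i i =
        star (star (evalReal Q x i)) ⬝ᵥ (W.toFun x *ᵥ star (evalReal Q x i)) := by
      intro x
      rw [mul_assoc, star_star]
      simp only [Matrix.mul_apply, dotProduct, Matrix.mulVec, Matrix.conjTranspose_apply,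
        Pi.star_apply]
    have hint := W.integrable_form Q Q i i
    have h0 : ∫ x in I, (evalReal Q x * W.toFun x * (evalReal Q x)ᴴ) i i = 0 := by
      have := congrFun (congrFun h i) i
      simpa [form] using this
    have hre : ∫ x in I, ((evalReal Q x * W.toFun x * (evalReal Q x)ᴴ) i i).re = 0 := by
      have := integral_re (𝕜 := ℂ) hint
      simp only [RCLike.re_eq_complex_re] at this
      rw [this, h0, Complex.zero_re]
    have hnn : 0 ≤ᵐ[volume.restrict I]
        fun x => ((evalReal Q x * W.toFun x * (evalReal Q x)ᴴ) i i).re := by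
      filter_upwards [W.posDef] with x hx
      rw [hexp]
      exact (Complex.le_def.1 (hx.posSemidef.dotProduct_mulVec_nonneg _)).1
    have hz := (integral_eq_zero_iff_of_nonneg_ae hnn hint.re).1 hre
    filter_upwards [hz, W.posDef] with x hx hpd
    by_contra hne
    have hne' : star (evalReal Q x i) ≠ 0 := by
      intro h'
      apply hne
      intro k
      have := congrFun h' k
      simpa using this
    have := (Complex.lt_def.1 (hpd.dotProduct_mulVec_pos hne')).1
    rw [← hexp] at this
    simp only [Pi.zero_apply] at hx
    rw [hx] at this
    simp at this
  have hall : ∀ᵐ x ∂(volume.restrict I), ∀ i k, evalReal Q x i k = 0 := ae_all_iff.2 key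
  have hinf : {x : ℝ | ∀ i k, evalReal Q x i k = 0}.Infinite := by
    intro hfin
    have h1 : volume.restrict I {x : ℝ | ∀ i k, evalReal Q x i k = 0} = 0 :=
      hfin.measure_zero _
    have h2 : volume.restrict I Set.univ = 0 := by
      rw [← Set.union_compl_self {x : ℝ | ∀ i k, evalReal Q x i k = 0}]
      exact measure_union_null h1 hall
    rw [Measure.restrict_apply_univ] at h2
    exact (W.isOpen.measure_pos volume W.nonempty).ne' h2
  have hq : matPolyEquiv.symm Q = 0 := by
    refine Matrix.ext fun i k => ?_
    rw [Matrix.zero_apply]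
    apply Polynomial.eq_zero_of_infinite_isRoot
    refine (hinf.image (f := fun x : ℝ => (x : ℂ)) Complex.ofReal_injective.injOn).mono ?_
    rintro _ ⟨x, hx, rfl⟩
    have := matPolyEquiv_eval (matPolyEquiv.symm Q) (x : ℂ) i k
    rw [AlgEquiv.apply_symm_apply] at this
    simp only [Set.mem_ofPred_eq, IsRoot.def]
    rw [← this]
    exact hx i k
  simpa using hq

/-- The linear system that determines the lower coefficients of the monic orthogonal
polynomials. -/
def gramMap (W : WeightMatrix N I) (n : ℕ) : (Fin n → Mat N) →ₗ[ℂ] (Fin n → Mat N) where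
  toFun c := fun j => ∑ k : Fin n, c k * W.form (X ^ (k : ℕ)) (X ^ (j : ℕ))
  map_add' := by
    intro c d
    funext j
    simp [add_mul, Finset.sum_add_distrib]
  map_smul' := by
    intro r c
    funext j
    simp [Finset.smul_sum]

lemma gramMap_surjective (W : WeightMatrix N I) (n : ℕ) : Function.Surjective (W.gramMap n) := by
  rw [← LinearMap.injective_iff_surjective, ← LinearMap.ker_eq_bot, LinearMap.ker_eq_bot']
  intro c hc
  set Q : MatPoly N := ∑ k : Fin n, c k • (X : MatPoly N) ^ (k : ℕ) with hQ
  have h1 : ∀ j : Fin n, W.form Q (X ^ (j : ℕ)) = 0 := by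
    intro j
    rw [hQ, form_sum_left]
    simp only [form_smul_left]
    exact congrFun hc j
  have h2 : W.form Q Q = 0 := by
    rw [← form_conj]
    nth_rewrite 1 [hQ]
    rw [form_sum_left]
    simp only [form_smul_left]
    rw [Finset.sum_eq_zero fun k _ => by rw [← form_conj, h1, Matrix.conjTranspose_zero, mul_zero],
      Matrix.conjTranspose_zero]
  have h3 := W.eq_zero_of_form_self Q h2
  funext j
  have h4 : Q.coeff (j : ℕ) = c j := by
    rw [hQ, finsetSum_coeff, Finset.sum_eq_single j]
    · simp [coeff_X_pow]
    · intro k _ hk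
      have : (j : ℕ) ≠ (k : ℕ) := fun h => hk (Fin.ext h.symm)
      simp [coeff_X_pow, this]
    · simp
  rw [← h4, h3]
  simp

/-- `P` is the sequence of monic orthogonal polynomials of `W`. -/
structure IsMonicOrthogonal (W : WeightMatrix N I) (P : ℕ → MatPoly N) : Prop where
  natDegree_le : ∀ n, (P n).natDegree ≤ n
  coeff_self : ∀ n, (P n).coeff n = 1
  orthogonal : ∀ n m, n ≠ m → W.form (P n) (P m) = 0

theorem exists_isMonicOrthogonal (W : WeightMatrix N I) : ∃ P, W.IsMonicOrthogonal P := by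
  have hex : ∀ n, ∃ Q : MatPoly N, Q.natDegree ≤ n ∧ Q.coeff n = 1 ∧
      ∀ j < n, W.form Q (X ^ j) = 0 := by
    intro n
    obtain ⟨c, hc⟩ := W.gramMap_surjective n (fun j => -W.form (X ^ n) (X ^ (j : ℕ)))
    refine ⟨X ^ n + ∑ k : Fin n, c k • (X : MatPoly N) ^ (k : ℕ), ?_, ?_, ?_⟩
    · refine natDegree_add_le_of_degree_le (natDegree_X_pow_le n) ?_
      refine natDegree_sum_le_of_forall_le _ _ fun k _ => ?_
      exact (natDegree_smul_le _ _).trans ((natDegree_X_pow_le _).trans k.2.le)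
    · rw [coeff_add, coeff_X_pow_self, finsetSum_coeff, Finset.sum_eq_zero, add_zero]
      intro k _
      have : n ≠ (k : ℕ) := k.2.ne'
      simp [coeff_X_pow, this]
    · intro j hj
      have := congrFun hc ⟨j, hj⟩
      rw [form_add_left, form_sum_left]
      simp only [form_smul_left]
      simp only [gramMap, LinearMap.coe_mk, AddHom.coe_mk] at this
      rw [this, add_neg_cancel]
  choose P hdeg hcoeff horth using hex
  have hlt : ∀ n m, m < n → W.form (P m) (P n) = 0 := by
    intro n m hmn
    rw [(P m).as_sum_range_C_mul_X_pow, form_sum_left]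
    refine Finset.sum_eq_zero fun k hk => ?_
    have hk' : k < n := by
      have := Finset.mem_range.1 hk
      have := hdeg m
      omega
    rw [← smul_eq_C_mul, form_smul_left, ← form_conj, horth n k hk', Matrix.conjTranspose_zero,
      mul_zero]
  refine ⟨P, hdeg, hcoeff, fun n m hnm => ?_⟩
  rcases lt_or_gt_of_ne hnm with h | h
  · exact hlt m n h
  · rw [← form_conj, hlt n m h, Matrix.conjTranspose_zero]

/-- The monic orthogonal polynomials `P_n` of `W`. -/
def monicOP (W : WeightMatrix N I) : ℕ → MatPoly N := W.exists_isMonicOrthogonal.choose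

lemma isMonicOrthogonal_monicOP (W : WeightMatrix N I) : W.IsMonicOrthogonal W.monicOP :=
  W.exists_isMonicOrthogonal.choose_spec

/-- The algebra `𝒟(W)` of the differential operators with polynomial coefficients that have all
the `P_n` as eigenfunctions, `P_n · D = Λ_n P_n` with `Λ_n` a constant matrix. -/
def diffAlgebra (W : WeightMatrix N I) : Subalgebra ℂ (RightOp N) where
  carrier := {D | D ∈ matDiffOps N ∧ ∀ n, ∃ Λ : Mat N, act (W.monicOP n) D = Λ • W.monicOP n}
  mul_mem' := by
    rintro D E ⟨hD, hD'⟩ ⟨hE, hE'⟩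
    refine ⟨mul_mem hD hE, fun n => ?_⟩
    obtain ⟨A, hA⟩ := hD' n
    obtain ⟨B, hB⟩ := hE' n
    exact ⟨A * B, by rw [act_mul, hA, act_smul, hB, mul_smul]⟩
  add_mem' := by
    rintro D E ⟨hD, hD'⟩ ⟨hE, hE'⟩
    refine ⟨add_mem hD hE, fun n => ?_⟩
    obtain ⟨A, hA⟩ := hD' n
    obtain ⟨B, hB⟩ := hE' n
    exact ⟨A + B, by rw [act_add, hA, hB, add_smul]⟩
  algebraMap_mem' := by
    intro r
    refine ⟨(matDiffOps N).algebraMap_mem r, fun n => ⟨algebraMap ℂ (Mat N) r, ?_⟩⟩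
    rw [algebraMap_smul]
    rfl

/-! ### Darboux transformations -/

/-- The factorization `D = V N` exhibits `W'` as a Darboux transformation of `W`: the factors are
degree-preserving differential operators and `P_n · V = A_n P'_n` for all `n`, where `P_n` and
`P'_n` are the monic orthogonal polynomials of `W` and `W'`. -/
structure IsDarbouxFactorization (W W' : WeightMatrix N I) (D : W.diffAlgebra)
    (V N' : matDiffOps N) : Prop where
  factor : (D : RightOp N) = V * N'
  degreePreserving_left : IsDegreePreserving (V : RightOp N)
  degreePreserving_right : IsDegreePreserving (N' : RightOp N)
  intertwines : ∀ n, ∃ A : Mat N, act (W.monicOP n) V = A • W'.monicOP n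

/-- `W'` is a Darboux transformation of `W`. -/
def IsDarbouxTransformation (W W' : WeightMatrix N I) : Prop :=
  ∃ (D : W.diffAlgebra) (V N' : matDiffOps N), IsDarbouxFactorization W W' D V N'

/-- Darboux equivalence: the equivalence relation generated by Darboux transformations, on the
weight matrices of size `N` on a common interval. -/
def DarbouxEquivalent (W W' : WeightMatrix N I) : Prop :=
  Relation.EqvGen IsDarbouxTransformation W W'

end WeightMatrix

/-! ### Classical scalar weights -/

/-- The three types of classical scalar weights. -/
inductive ClassicalType
  | hermite
  | laguerre
  | jacobi

/-- The interval that supports the classical weights of a given type. -/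
def ClassicalType.support : ClassicalType → Set ℝ
  | .hermite => Set.univ
  | .laguerre => Set.Ioi 0
  | .jacobi => Set.Ioo (-1) 1

/-- The classical scalar weights of each type, given by their parameters. -/
inductive ClassicalWeight : ClassicalType → Type
  | hermite (b : ℝ) : ClassicalWeight .hermite
  | laguerre (α : ℝ) (hα : -1 < α) : ClassicalWeight .laguerre
  | jacobi (α β : ℝ) (hα : -1 < α) (hβ : -1 < β) : ClassicalWeight .jacobi

/-- The weight function: `e^{-x²+2bx}` (shifted Hermite), `e^{-x} x^α` (Laguerre) and
`(1-x)^α (1+x)^β` (Jacobi). -/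
def ClassicalWeight.toFun : {t : ClassicalType} → ClassicalWeight t → ℝ → ℝ
  | _, .hermite b, x => Real.exp (-x ^ 2 + 2 * b * x)
  | _, .laguerre α _, x => Real.exp (-x) * x ^ α
  | _, .jacobi α β _ _, x => (1 - x) ^ α * (1 + x) ^ β

namespace ClassicalWeight

variable {t : ClassicalType}

lemma toFun_pos (w : ClassicalWeight t) {x : ℝ} (hx : x ∈ t.support) : 0 < w.toFun x := by
  cases w with
  | hermite b => exact Real.exp_pos _
  | laguerre α hα => exact mul_pos (Real.exp_pos _) (Real.rpow_pos_of_pos hx _)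
  | jacobi α β hα hβ =>
    have h1 : 0 < 1 - x := by linarith [hx.2]
    have h2 : 0 < 1 + x := by linarith [hx.1]
    exact mul_pos (Real.rpow_pos_of_pos h1 _) (Real.rpow_pos_of_pos h2 _)

lemma contDiffOn_toFun (w : ClassicalWeight t) : ContDiffOn ℝ ∞ w.toFun t.support := by
  cases w with
  | hermite b =>
    have : ContDiff ℝ ∞ fun x : ℝ => Real.exp (-x ^ 2 + 2 * b * x) := by fun_prop
    exact this.contDiffOn
  | laguerre α hα =>
    have h1 : ContDiffOn ℝ ∞ (fun x : ℝ => Real.exp (-x)) (Set.Ioi 0) := by fun_prop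
    exact h1.mul (contDiffOn_id.rpow_const_of_ne fun x hx => ne_of_gt hx)
  | jacobi α β hα hβ =>
    have h1 : ContDiffOn ℝ ∞ (fun x : ℝ => 1 - x) (Set.Ioo (-1) 1) := by fun_prop
    have h2 : ContDiffOn ℝ ∞ (fun x : ℝ => 1 + x) (Set.Ioo (-1) 1) := by fun_prop
    refine (h1.rpow_const_of_ne fun x hx => ?_).mul (h2.rpow_const_of_ne fun x hx => ?_)
    · linarith [hx.2]
    · linarith [hx.1]

lemma integrable_pow_mul_exp (n : ℕ) :
    Integrable fun x : ℝ => x ^ n * Real.exp (-x ^ 2) := by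
  have h := integrable_rpow_mul_exp_neg_mul_sq (b := 1) one_pos (s := (n : ℝ))
    (by have : (0 : ℝ) ≤ n := n.cast_nonneg
        linarith)
  simpa [Real.rpow_natCast] using h

lemma integrableOn_jacobi {α β : ℝ} (hα : -1 < α) (hβ : -1 < β) :
    IntegrableOn (fun x : ℝ => (1 - x) ^ α * (1 + x) ^ β) (Set.Ioo (-1) 1) := by
  have h1 : IntervalIntegrable (fun x : ℝ => (1 - x) ^ α * (1 + x) ^ β) volume (-1) 0 := by
    have h := (intervalIntegral.intervalIntegrable_rpow' (a := 0) (b := 1) hβ).comp_add_left 1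
    norm_num at h
    refine h.continuousOn_mul ?_
    refine ContinuousOn.rpow_const (by fun_prop) fun x hx => Or.inl ?_
    rw [Set.uIcc_of_le (by norm_num)] at hx
    linarith [hx.2]
  have h2 : IntervalIntegrable (fun x : ℝ => (1 - x) ^ α * (1 + x) ^ β) volume 0 1 := by
    have h := ((intervalIntegral.intervalIntegrable_rpow' (a := 0) (b := 1) hα).comp_sub_left 1).symm
    norm_num at h
    refine h.mul_continuousOn ?_
    refine ContinuousOn.rpow_const (by fun_prop) fun x hx => Or.inl ?_
    rw [Set.uIcc_of_le (by norm_num)] at hx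
    linarith [hx.1]
  exact ((intervalIntegrable_iff_integrableOn_Ioo_of_le (by norm_num)).1 (h1.trans h2))

lemma moments (w : ClassicalWeight t) (n : ℕ) :
    IntegrableOn (fun x : ℝ => x ^ n * w.toFun x) t.support := by
  cases w with
  | hermite b =>
    have h : Integrable fun y : ℝ => (y + b) ^ n * Real.exp (-y ^ 2) := by
      simp only [add_pow, Finset.sum_mul]
      refine integrable_finsetSum _ fun k _ => ?_
      refine ((integrable_pow_mul_exp k).const_mul (b ^ (n - k) * (n.choose k))).congr ?_
      filter_upwards with y
      ring
    have h2 := (h.comp_sub_right b).const_mul (Real.exp (b ^ 2))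
    refine Integrable.integrableOn (h2.congr ?_)
    filter_upwards with x
    simp only [toFun, sub_add_cancel]
    rw [mul_left_comm, ← Real.exp_add]
    ring_nf
  | laguerre α hα =>
    have hs : 0 < α + n + 1 := by
      have : (0 : ℝ) ≤ n := n.cast_nonneg
      linarith
    refine (Real.GammaIntegral_convergent hs).congr_fun (fun x hx => ?_) measurableSet_Ioi
    have hx' : (0 : ℝ) < x := hx
    simp only [toFun, add_sub_cancel_right]
    rw [Real.rpow_add hx', Real.rpow_natCast]
    ring
  | jacobi α β hα hβ =>
    refine Integrable.bdd_mul (c := 1) (integrableOn_jacobi hα hβ)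
      (Continuous.aestronglyMeasurable (by fun_prop)) ?_
    refine (ae_restrict_iff' measurableSet_Ioo).2 (Filter.Eventually.of_forall fun x hx => ?_)
    rw [norm_pow]
    exact pow_le_one₀ (norm_nonneg _) (abs_le.2 ⟨hx.1.le, hx.2.le⟩)

end ClassicalWeight

/-- The direct sum `w_1 ⊕ ⋯ ⊕ w_N` of classical scalar weights supported on the same interval,
that is, the weight matrix `diag (w_1, …, w_N)`. -/
def directSum {N : ℕ} {t : ClassicalType} (w : Fin N → ClassicalWeight t) :
    WeightMatrix N t.support where
  toFun x := Matrix.diagonal fun i => ((w i).toFun x : ℂ)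
  isOpen := by
    cases t
    exacts [isOpen_univ, isOpen_Ioi, isOpen_Ioo]
  ordConnected := by
    cases t
    exacts [Set.ordConnected_univ, Set.ordConnected_Ioi, Set.ordConnected_Ioo]
  nonempty := by
    cases t
    exacts [Set.univ_nonempty, Set.nonempty_Ioi, Set.nonempty_Ioo.2 (by norm_num)]
  smooth := by
    intro i j
    by_cases h : i = j
    · subst h
      simp only [Matrix.diagonal_apply_eq]
      exact Complex.ofRealCLM.contDiff.comp_contDiffOn (w i).contDiffOn_toFun
    · simpa [Matrix.diagonal_apply_ne _ h] using contDiffOn_const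
  posDef := by
    have hm : MeasurableSet t.support := by
      cases t
      exacts [MeasurableSet.univ, measurableSet_Ioi, measurableSet_Ioo]
    refine (ae_restrict_iff' hm).2 (Filter.Eventually.of_forall fun x hx => ?_)
    refine Matrix.PosDef.diagonal fun i => ?_
    exact_mod_cast (w i).toFun_pos hx
  moments := by
    intro n i j
    by_cases h : i = j
    · subst h
      simpa [IntegrableOn] using ((w i).moments n).ofReal (𝕜 := ℂ)
    · simp [Matrix.diagonal_apply_ne _ h]

end MatrixBochner

end

open MatrixBochner

noncomputable section

namespace MatrixBochner

/-! ### Matrix polynomials expanded in a monic sequence -/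

variable {N : ℕ}

lemma act_add_left (P Q : MatPoly N) (D : RightOp N) : act (P + Q) D = act P D + act Q D :=
  D.unop.map_add P Q

lemma act_sub_left (P Q : MatPoly N) (D : RightOp N) : act (P - Q) D = act P D - act Q D :=
  D.unop.map_sub P Q

lemma act_zero_left (D : RightOp N) : act 0 D = 0 := D.unop.map_zero

lemma act_one (P : MatPoly N) : act P (1 : RightOp N) = P := rfl

lemma degree_le_of_lt_add_one {Q : MatPoly N} {n : ℕ} (h : Q.degree < ((n + 1 : ℕ) : WithBot ℕ)) :
    Q.degree ≤ n := by
  rw [degree_lt_iff_coeff_zero] at h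
  rw [degree_le_iff_coeff_zero]
  exact fun m hm => h m (by exact_mod_cast hm)

lemma degree_sub_coeff_smul_lt {p : ℕ → MatPoly N} (hdeg : ∀ n, (p n).natDegree ≤ n)
    (hcoeff : ∀ n, (p n).coeff n = 1) {Q : MatPoly N} {n : ℕ} (hQ : Q.natDegree ≤ n) :
    (Q - Q.coeff n • p n).degree < n := by
  rw [degree_lt_iff_coeff_zero]
  intro m hm
  rcases hm.eq_or_lt with rfl | hm
  · simp [hcoeff]
  · simp [coeff_eq_zero_of_natDegree_lt (hQ.trans_lt hm),
      coeff_eq_zero_of_natDegree_lt ((hdeg n).trans_lt hm)]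

lemma mem_span_of_degree_lt {p : ℕ → MatPoly N} (hdeg : ∀ n, (p n).natDegree ≤ n)
    (hcoeff : ∀ n, (p n).coeff n = 1) (n : ℕ) (Q : MatPoly N) (hQ : Q.degree < n) :
    Q ∈ Submodule.span (Mat N) (p '' Set.Iio n) := by
  induction n generalizing Q with
  | zero =>
    have : Q = 0 := by
      ext1 k
      simpa using coeff_eq_zero_of_degree_lt (hQ.trans_le (by simp))
    simp [this]
  | succ n ih =>
    have hQ' : Q.natDegree ≤ n := by
      rw [natDegree_le_iff_degree_le]
      exact degree_le_of_lt_add_one hQ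
    have h1 := ih _ (degree_sub_coeff_smul_lt hdeg hcoeff hQ')
    have h2 : Q = (Q - Q.coeff n • p n) + Q.coeff n • p n := by abel
    rw [h2]
    refine add_mem (Submodule.span_mono (Set.image_mono fun k (hk : k < n) =>
      Nat.lt_succ_of_lt hk) h1) (Submodule.smul_mem _ _ (Submodule.subset_span ⟨n, ?_, rfl⟩))
    exact Nat.lt_succ_self n

lemma mem_span_range {p : ℕ → MatPoly N} (hdeg : ∀ n, (p n).natDegree ≤ n)
    (hcoeff : ∀ n, (p n).coeff n = 1) (Q : MatPoly N) :
    Q ∈ Submodule.span (Mat N) (Set.range p) :=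
  Submodule.span_mono (Set.image_subset_range _ _)
    (mem_span_of_degree_lt hdeg hcoeff (Q.natDegree + 1) Q
      (degree_le_natDegree.trans_lt (by exact_mod_cast Nat.lt_succ_self _)))

lemma isUnit_of_mul_eq_zero {A : Mat N} (hreg : ∀ B : Mat N, B * A = 0 → B = 0) : IsUnit A := by
  have hinj : Function.Injective fun B : Mat N => B * A := fun B B' h =>
    sub_eq_zero.1 (hreg _ (by rw [sub_mul]; exact sub_eq_zero.2 h))
  have hsurj : Function.Surjective (LinearMap.mulRight ℂ A) :=
    LinearMap.injective_iff_surjective.1 hinj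
  obtain ⟨B, hB⟩ := hsurj 1
  exact IsUnit.of_mul_eq_one_right B hB

/-- Operators that do not raise the degree. -/
def IsDegreeNonraising (L : RightOp N) : Prop := ∀ P : MatPoly N, (act P L).degree ≤ P.degree

namespace WeightMatrix

variable {I : Set ℝ} (W : WeightMatrix N I)

lemma natDegree_monicOP_le (n : ℕ) : (W.monicOP n).natDegree ≤ n :=
  W.isMonicOrthogonal_monicOP.natDegree_le n

lemma coeff_monicOP_self (n : ℕ) : (W.monicOP n).coeff n = 1 :=
  W.isMonicOrthogonal_monicOP.coeff_self n

lemma form_monicOP_of_ne {n m : ℕ} (h : n ≠ m) : W.form (W.monicOP n) (W.monicOP m) = 0 :=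
  W.isMonicOrthogonal_monicOP.orthogonal n m h

lemma smul_monicOP_injective {n : ℕ} {A B : Mat N} (h : A • W.monicOP n = B • W.monicOP n) :
    A = B := by
  have := congrArg (fun P => P.coeff n) h
  simpa [coeff_monicOP_self] using this

lemma degree_smul_monicOP {n : ℕ} {A : Mat N} (hA : A ≠ 0) : (A • W.monicOP n).degree = n := by
  refine le_antisymm ?_ (le_degree_of_ne_zero ?_)
  · exact (degree_smul_le _ _).trans (natDegree_le_iff_degree_le.1 (W.natDegree_monicOP_le n))
  · simpa [coeff_monicOP_self] using hA

lemma degree_smul_monicOP_le (n : ℕ) (A : Mat N) : (A • W.monicOP n).degree ≤ n :=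
  (degree_smul_le _ _).trans (natDegree_le_iff_degree_le.1 (W.natDegree_monicOP_le n))

lemma ext_of_act_monicOP {D E : RightOp N}
    (h : ∀ n, act (W.monicOP n) D = act (W.monicOP n) E) : D = E := by
  refine rightOp_ext fun P => ?_
  have hP := mem_span_range W.natDegree_monicOP_le W.coeff_monicOP_self P
  induction hP using Submodule.span_induction with
  | mem x hx => obtain ⟨n, rfl⟩ := hx; exact h n
  | zero => rw [act_zero_left, act_zero_left]
  | add x y _ _ hx hy => rw [act_add_left, act_add_left, hx, hy]
  | smul A x _ hx => rw [act_smul, act_smul, hx]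

lemma degree_act_lt {W' : WeightMatrix N I} {V : RightOp N} {A : ℕ → Mat N}
    (hV : ∀ n, act (W.monicOP n) V = A n • W'.monicOP n) {n : ℕ} {P : MatPoly N}
    (hP : P.degree < n) : (act P V).degree < n := by
  replace hP := mem_span_of_degree_lt W.natDegree_monicOP_le W.coeff_monicOP_self n P hP
  induction hP using Submodule.span_induction with
  | mem x hx =>
    obtain ⟨k, hk, rfl⟩ := hx
    rw [hV]
    exact (W'.degree_smul_monicOP_le k _).trans_lt (by exact_mod_cast hk)
  | zero => simp [act_zero_left]
  | add x y _ _ hx hy =>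
    rw [act_add_left]
    exact (degree_add_le _ _).trans_lt (max_lt hx hy)
  | smul A x _ hx => rw [act_smul]; exact (degree_smul_le _ _).trans_lt hx

lemma isDegreePreserving_of_isUnit {V : RightOp N} {A : ℕ → Mat N}
    (hV : ∀ n, act (W.monicOP n) V = A n • W.monicOP n) (hA : ∀ n, IsUnit (A n)) :
    IsDegreePreserving V := by
  intro P
  by_cases hP : P = 0
  · simp [hP, act_zero_left]
  set n := P.natDegree with hn
  have hB : P.coeff n ≠ 0 := by simpa [hn] using hP
  have hlt := degree_sub_coeff_smul_lt W.natDegree_monicOP_le W.coeff_monicOP_self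
    (Q := P) (n := n) le_rfl
  have hsplit : act P V = act (P - P.coeff n • W.monicOP n) V +
      (P.coeff n * A n) • W.monicOP n := by
    rw [act_sub_left, act_smul, hV, mul_smul, sub_add_cancel]
  have hBA : P.coeff n * A n ≠ 0 := fun h => hB ((hA n).mul_left_eq_zero.1 h)
  rw [hsplit, degree_add_eq_right_of_degree_lt, W.degree_smul_monicOP hBA,
    degree_eq_natDegree hP]
  rw [W.degree_smul_monicOP hBA]
  exact W.degree_act_lt hV hlt

lemma isUnit_of_isDegreePreserving {W' : WeightMatrix N I} {V : RightOp N}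
    (hdp : IsDegreePreserving V) {n : ℕ} {A : Mat N}
    (hV : act (W.monicOP n) V = A • W'.monicOP n) : IsUnit A := by
  have hreg : ∀ B : Mat N, B * A = 0 → B = 0 := by
    intro B hBA
    by_contra hB
    have h := hdp (B • W.monicOP n)
    rw [act_smul, hV, ← mul_smul, hBA, zero_smul, W.degree_smul_monicOP hB] at h
    simp at h
  exact isUnit_of_mul_eq_zero hreg

/-! ### The algebra `𝒟(W)` as sequences of eigenvalues -/

lemma act_monicOP_of_mem {D : RightOp N} (hD : D ∈ W.diffAlgebra) (n : ℕ) :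
    act (W.monicOP n) D = (act (W.monicOP n) D).coeff n • W.monicOP n := by
  obtain ⟨Λ, hΛ⟩ := hD.2 n
  rw [hΛ]
  simp [coeff_monicOP_self]

/-- The homomorphism that sends `D ∈ 𝒟(W)` to its sequence of eigenvalues `Λ_n`. -/
def eigenHom : W.diffAlgebra →ₐ[ℂ] (ℕ → Mat N) where
  toFun D n := (act (W.monicOP n) D).coeff n
  map_one' := by
    funext n
    simp [act_one, coeff_monicOP_self]
  map_mul' D E := by
    funext n
    rw [Pi.mul_apply, Subalgebra.coe_mul, act_mul, W.act_monicOP_of_mem D.2, act_smul,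
      coeff_smul, coeff_smul, coeff_monicOP_self, smul_eq_mul, smul_eq_mul, mul_one]
  map_zero' := by
    funext n
    change (0 : MatPoly N).coeff n = 0
    simp
  map_add' D E := by
    funext n
    rw [Pi.add_apply, Subalgebra.coe_add, act_add, coeff_add]
  commutes' r := by
    funext n
    change (r • W.monicOP n).coeff n = _
    rw [coeff_smul, coeff_monicOP_self, Pi.algebraMap_apply, Algebra.algebraMap_eq_smul_one]

lemma eigenHom_apply (D : W.diffAlgebra) (n : ℕ) :
    W.eigenHom D n = (act (W.monicOP n) D).coeff n := rfl

lemma act_monicOP (D : W.diffAlgebra) (n : ℕ) :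
    act (W.monicOP n) D = W.eigenHom D n • W.monicOP n := W.act_monicOP_of_mem D.2 n

lemma eigenHom_injective : Function.Injective W.eigenHom := by
  intro D E h
  refine Subtype.ext (W.ext_of_act_monicOP fun n => ?_)
  rw [act_monicOP, act_monicOP, h]

lemma eigenHom_eq_of_act {D : W.diffAlgebra} {n : ℕ} {A : Mat N}
    (h : act (W.monicOP n) D = A • W.monicOP n) : W.eigenHom D n = A :=
  W.smul_monicOP_injective (by rw [← act_monicOP, h])

/-! ### Darboux equivalence is realized by a single Darboux transformation -/

variable {W}

lemma IsDarbouxTransformation.refl (W : WeightMatrix N I) : IsDarbouxTransformation W W :=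
  ⟨1, 1, 1, by simp, fun _ => rfl, fun _ => rfl, fun n => ⟨1, by rw [one_smul]; rfl⟩⟩

lemma IsDarbouxFactorization.exists_right {W W' : WeightMatrix N I} {D : W.diffAlgebra}
    {V N' : matDiffOps N} (h : IsDarbouxFactorization W W' D V N') (n : ℕ) :
    ∃ B : Mat N, act (W'.monicOP n) N' = B • W.monicOP n := by
  obtain ⟨A, hA⟩ := h.intertwines n
  obtain ⟨u, hu⟩ := W.isUnit_of_isDegreePreserving h.degreePreserving_left hA
  have h1 : W'.monicOP n = (↑u⁻¹ : Mat N) • act (W.monicOP n) V := by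
    rw [hA, ← hu, ← mul_smul, Units.inv_mul, one_smul]
  refine ⟨↑u⁻¹ * W.eigenHom D n, ?_⟩
  rw [h1, act_smul, ← act_mul, ← h.factor, act_monicOP, mul_smul]

lemma IsDarbouxTransformation.symm {W W' : WeightMatrix N I} (h : IsDarbouxTransformation W W') :
    IsDarbouxTransformation W' W := by
  obtain ⟨D, V, N', h⟩ := h
  have hN := h.exists_right
  refine ⟨⟨N' * V, mul_mem N'.2 V.2, fun n => ?_⟩, N', V, rfl, h.degreePreserving_right,
    h.degreePreserving_left, hN⟩
  obtain ⟨B, hB⟩ := hN n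
  obtain ⟨A, hA⟩ := h.intertwines n
  exact ⟨B * A, by rw [act_mul, hB, act_smul, hA, mul_smul]⟩

lemma IsDarbouxTransformation.trans {W W' W'' : WeightMatrix N I}
    (h : IsDarbouxTransformation W W') (h' : IsDarbouxTransformation W' W'') :
    IsDarbouxTransformation W W'' := by
  obtain ⟨D, V, M, h⟩ := h
  obtain ⟨D', V', M', h'⟩ := h'
  have hV : ∀ n, ∃ A : Mat N, act (W.monicOP n) (V * V' : RightOp N) = A • W''.monicOP n := by
    intro n
    obtain ⟨A, hA⟩ := h.intertwines n
    obtain ⟨A', hA'⟩ := h'.intertwines n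
    exact ⟨A * A', by rw [act_mul, hA, act_smul, hA', mul_smul]⟩
  refine ⟨⟨V * V' * (M' * M), mul_mem (mul_mem V.2 V'.2) (mul_mem M'.2 M.2), fun n => ?_⟩,
    V * V', M' * M, rfl, fun P => ?_, fun P => ?_, hV⟩
  · obtain ⟨A, hA⟩ := hV n
    obtain ⟨B', hB'⟩ := h'.exists_right n
    obtain ⟨B, hB⟩ := h.exists_right n
    exact ⟨A * (B' * B), by rw [act_mul, hA, act_smul, act_mul, hB', act_smul, hB, mul_smul,
      mul_smul]⟩
  · rw [Subalgebra.coe_mul, act_mul, h'.degreePreserving_left, h.degreePreserving_left]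
  · rw [Subalgebra.coe_mul, act_mul, h.degreePreserving_right, h'.degreePreserving_right]

lemma DarbouxEquivalent.isDarbouxTransformation {W W' : WeightMatrix N I}
    (h : DarbouxEquivalent W W') : IsDarbouxTransformation W W' := by
  induction h with
  | rel _ _ h => exact h
  | refl _ => exact .refl _
  | symm _ _ _ h => exact h.symm
  | trans _ _ _ _ _ h h' => exact h.trans h'

end WeightMatrix
end MatrixBochner

end

noncomputable section

namespace MatrixBochner

/-! ### Differential operators are the operators on which `ad x` is nilpotent -/

variable {N : ℕ}

lemma act_sub (P : MatPoly N) (D E : RightOp N) : act P (D - E) = act P D - act P E := rfl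

lemma act_neg (P : MatPoly N) (D : RightOp N) : act P (-D) = -act P D := rfl

lemma act_monoOp_zero (P F : MatPoly N) : act P (monoOp 0 F) = P * F := by
  rw [act_monoOp, Function.iterate_zero, id]

/-- The commutator with multiplication by `x`. -/
def adX : AddMonoid.End (RightOp N) where
  toFun L := monoOp 0 X * L - L * monoOp 0 X
  map_zero' := rightOp_ext fun P => by
    rw [act_sub, act_mul, act_mul, act_monoOp_zero, act_monoOp_zero]
    change (0 : MatPoly N) - 0 * X = 0
    rw [zero_mul, sub_zero]
  map_add' L L' := rightOp_ext fun P => by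
    rw [act_add, act_sub, act_sub, act_sub, act_mul, act_mul, act_mul, act_mul, act_mul, act_mul,
      act_add, act_add, act_monoOp_zero, act_monoOp_zero, act_monoOp_zero, act_monoOp_zero, add_mul,
      add_sub_add_comm]

lemma act_adX (P : MatPoly N) (L : RightOp N) : act P (adX L) = act (P * X) L - act P L * X := by
  change act P (monoOp 0 X * L - L * monoOp 0 X) = _
  rw [act_sub, act_mul, act_mul, act_monoOp_zero, act_monoOp_zero]

lemma adX_monoOp_zero (F : MatPoly N) : adX (monoOp 0 F) = 0 := by
  refine rightOp_ext fun P => ?_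
  rw [act_adX, act_monoOp_zero, act_monoOp_zero, mul_assoc, mul_assoc, X_mul, sub_self]
  rfl

lemma iterate_derivative_succ_mul_X (k : ℕ) (P : MatPoly N) :
    derivative^[k + 1] (P * X) = derivative^[k + 1] P * X + (k + 1) • derivative^[k] P := by
  induction k with
  | zero => simp
  | succ k ih =>
    rw [Function.iterate_succ_apply', ih, derivative_add, derivative_mul, derivative_smul,
      ← Function.iterate_succ_apply' derivative k, ← Function.iterate_succ_apply' derivative (k + 1),
      derivative_X, mul_one, add_assoc, add_comm (derivative^[k + 1] P), ← succ_nsmul]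

lemma adX_monoOp_succ (k : ℕ) (F : MatPoly N) :
    adX (monoOp (k + 1) F) = monoOp k (((k : ℂ) + 1) • F) := by
  refine rightOp_ext fun P => ?_
  rw [act_adX, act_monoOp, act_monoOp, act_monoOp, iterate_derivative_succ_mul_X, add_mul,
    mul_assoc, mul_assoc _ F, X_mul, add_sub_cancel_left, ← Nat.cast_succ,
    Nat.cast_smul_eq_nsmul, smul_mul_assoc, mul_smul_comm]

lemma adX_iterate_monoOp (k : ℕ) (F : MatPoly N) : adX^[k + 1] (monoOp k F) = 0 := by
  induction k generalizing F with
  | zero => exact adX_monoOp_zero F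
  | succ k ih => rw [Function.iterate_succ_apply, adX_monoOp_succ, ih]

lemma IsDiffOp.exists_adX_iterate_eq_zero {D : RightOp N} (hD : IsDiffOp D) :
    ∃ m, adX^[m] D = 0 := by
  obtain ⟨m, F, rfl⟩ := hD
  refine ⟨m + 1, ?_⟩
  rw [diffOp_eq_sum, ← AddMonoid.End.coe_pow, map_sum]
  refine Finset.sum_eq_zero fun i hi => ?_
  have hi : m + 1 = (m - i) + (i + 1) := by have := Finset.mem_range.1 hi; omega
  rw [AddMonoid.End.coe_pow, hi, Function.iterate_add_apply, adX_iterate_monoOp,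
    ← AddMonoid.End.coe_pow, map_zero]

lemma eq_monoOp_zero_of_adX_eq_zero {L : RightOp N} (hL : adX L = 0) :
    L = monoOp 0 (act 1 L) := by
  have h1 : ∀ P, act (P * X) L = act P L * X := fun P => by
    have := act_adX P L
    rw [hL] at this
    exact sub_eq_zero.1 this.symm
  have h2 : ∀ k, act (X ^ k) L = X ^ k * act 1 L := by
    intro k
    induction k with
    | zero => simp
    | succ k ih => rw [pow_succ, h1, ih, mul_assoc, mul_assoc, X_mul]
  refine rightOp_ext fun P => ?_
  rw [act_monoOp_zero]
  induction P using Polynomial.induction_on' with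
  | add P Q hP hQ => rw [act_add_left, hP, hQ, add_mul]
  | monomial k A => rw [← C_mul_X_pow_eq_monomial, ← smul_eq_C_mul, act_smul, h2, smul_mul_assoc]

lemma isDiffOp_of_adX_iterate_eq_zero {m : ℕ} {L : RightOp N} (hL : adX^[m] L = 0) :
    IsDiffOp L := by
  induction m generalizing L with
  | zero => rw [show L = 0 from hL]; exact IsDiffOp.zero
  | succ m ih =>
    obtain ⟨k, F, hF⟩ := ih (by rwa [Function.iterate_succ_apply] at hL)
    set L₀ : RightOp N := ∑ i ∈ Finset.range (k + 1), monoOp (i + 1) (((i : ℂ) + 1)⁻¹ • F i)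
      with hL₀
    have h1 : adX (L - L₀) = 0 := by
      refine (map_sub adX L L₀).trans (sub_eq_zero.2 ?_)
      rw [hF, diffOp_eq_sum, hL₀, map_sum]
      refine Finset.sum_congr rfl fun i _ => ?_
      rw [adX_monoOp_succ, smul_smul, mul_inv_cancel₀ (by exact_mod_cast i.succ_ne_zero),
        one_smul]
    have h2 : L = monoOp 0 (act 1 (L - L₀)) + L₀ := by
      rw [← eq_monoOp_zero_of_adX_eq_zero h1]
      exact (sub_add_cancel L L₀).symm
    rw [h2]
    exact (isDiffOp_monoOp _ _).add (IsDiffOp.sum _ _ fun i => isDiffOp_monoOp _ _)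

namespace WeightMatrix

variable {I : Set ℝ} (W : WeightMatrix N I)

/-! ### Adjoints -/

/-- `L'` is the adjoint of `L` for the form of `W`. -/
def IsAdjoint (L L' : RightOp N) : Prop :=
  ∀ P Q, W.form (act P L) Q = W.form P (act Q L')

lemma form_add_right (P Q Q' : MatPoly N) : W.form P (Q + Q') = W.form P Q + W.form P Q' := by
  rw [← form_conj, form_add_left, Matrix.conjTranspose_add, form_conj, form_conj]

lemma form_smul_right (A : Mat N) (P Q : MatPoly N) : W.form P (A • Q) = W.form P Q * Aᴴ := by
  rw [← form_conj, form_smul_left, Matrix.conjTranspose_mul, form_conj]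

lemma form_zero_right (P : MatPoly N) : W.form P 0 = 0 := by
  rw [← form_conj, form_zero_left, Matrix.conjTranspose_zero]

lemma form_neg_right (P Q : MatPoly N) : W.form P (-Q) = -W.form P Q := by
  rw [eq_neg_iff_add_eq_zero, ← form_add_right, neg_add_cancel, form_zero_right]

lemma form_sub_left (P P' Q : MatPoly N) : W.form (P - P') Q = W.form P Q - W.form P' Q := by
  rw [eq_sub_iff_add_eq, ← form_add_left, sub_add_cancel]

lemma form_sub_right (P Q Q' : MatPoly N) : W.form P (Q - Q') = W.form P Q - W.form P Q' := by
  rw [eq_sub_iff_add_eq, ← form_add_right, sub_add_cancel]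

lemma evalReal_mul_X (P : MatPoly N) (x : ℝ) : evalReal (P * X) x = (x : ℂ) • evalReal P x := by
  rw [evalReal, eval_mul_X, ← Algebra.commutes, ← Algebra.smul_def, evalReal]

lemma form_mul_X (P Q : MatPoly N) : W.form (P * X) Q = W.form P (Q * X) := by
  ext i j
  simp only [form, evalReal_mul_X, Matrix.conjTranspose_smul, Matrix.of_apply, smul_mul_assoc,
    mul_smul_comm, Complex.star_def, Complex.conj_ofReal]

variable {W}

lemma IsAdjoint.adX {L L' : RightOp N} (h : W.IsAdjoint L L') :
    W.IsAdjoint (adX L) (-(adX L')) := by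
  intro P Q
  rw [act_adX, act_neg, act_adX, form_sub_left, h, form_mul_X, form_mul_X, h, form_neg_right,
    form_sub_right, neg_sub]

lemma IsAdjoint.eq_zero {L' : RightOp N} (h : W.IsAdjoint 0 L') : L' = 0 := by
  refine rightOp_ext fun Q => ?_
  refine W.eq_zero_of_form_self _ ?_
  rw [← h]
  exact W.form_zero_left _

lemma IsAdjoint.adX_iterate_eq_zero {m : ℕ} {L L' : RightOp N} (h : W.IsAdjoint L L')
    (hL : MatrixBochner.adX^[m] L = 0) : MatrixBochner.adX^[m] L' = 0 := by
  induction m generalizing L L' with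
  | zero =>
    rw [show L = 0 from hL] at h
    exact h.eq_zero
  | succ m ih =>
    rw [Function.iterate_succ_apply] at hL ⊢
    have := ih h.adX hL
    rw [← AddMonoid.End.coe_pow] at this ⊢
    exact neg_eq_zero.1 ((map_neg (MatrixBochner.adX ^ m) (MatrixBochner.adX L')).symm.trans this)

lemma IsAdjoint.isDiffOp {L L' : RightOp N} (h : W.IsAdjoint L L') (hL : IsDiffOp L) :
    IsDiffOp L' := by
  obtain ⟨m, hm⟩ := hL.exists_adX_iterate_eq_zero
  exact isDiffOp_of_adX_iterate_eq_zero (h.adX_iterate_eq_zero hm)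

lemma form_monicOP_of_degree_lt {n : ℕ} {Q : MatPoly N} (hQ : Q.degree < n) :
    W.form (W.monicOP n) Q = 0 := by
  replace hQ := mem_span_of_degree_lt W.natDegree_monicOP_le W.coeff_monicOP_self n Q hQ
  induction hQ using Submodule.span_induction with
  | mem x hx =>
    obtain ⟨k, hk, rfl⟩ := hx
    exact W.form_monicOP_of_ne (ne_of_gt hk)
  | zero => exact W.form_zero_right _
  | add x y _ _ hx hy => rw [form_add_right, hx, hy, add_zero]
  | smul A x _ hx => rw [form_smul_right, hx, zero_mul]

/-- A differential operator with an adjoint belongs to `𝒟(W)` as soon as neither of the two raises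
the degree. -/
lemma IsAdjoint.mem_diffAlgebra {L L' : RightOp N} (h : W.IsAdjoint L L') (hL : IsDiffOp L)
    (hdeg : IsDegreeNonraising L) (hdeg' : IsDegreeNonraising L') : L ∈ W.diffAlgebra := by
  refine ⟨hL, fun n => ⟨(act (W.monicOP n) L).coeff n, sub_eq_zero.1 ?_⟩⟩
  have hle : (act (W.monicOP n) L).natDegree ≤ n :=
    natDegree_le_natDegree (hdeg _) |>.trans (W.natDegree_monicOP_le n)
  set R := act (W.monicOP n) L - (act (W.monicOP n) L).coeff n • W.monicOP n with hR
  have hlt : R.degree < n := degree_sub_coeff_smul_lt W.natDegree_monicOP_le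
    W.coeff_monicOP_self hle
  refine W.eq_zero_of_form_self _ ?_
  nth_rewrite 1 [hR]
  rw [form_sub_left, h, form_smul_left, form_monicOP_of_degree_lt hlt,
    form_monicOP_of_degree_lt ((hdeg' _).trans_lt hlt), mul_zero, sub_zero]

variable (W)

lemma isUnit_form_monicOP (n : ℕ) : IsUnit (W.form (W.monicOP n) (W.monicOP n)) := by
  refine isUnit_of_mul_eq_zero fun B hB => ?_
  have h : B • W.monicOP n = 0 := W.eq_zero_of_form_self _ (by
    rw [form_smul_left, form_smul_right, ← mul_assoc, hB, zero_mul])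
  simpa [coeff_monicOP_self] using congrArg (fun P => P.coeff n) h

lemma linearIndependent_monicOP : LinearIndependent (Mat N) W.monicOP := by
  rw [linearIndependent_iff']
  intro s c hc i hi
  have h := congrArg (fun P => W.form P (W.monicOP i)) hc
  simp only [form_sum_left, form_smul_left, form_zero_left] at h
  rw [Finset.sum_eq_single i (fun j _ hj => by rw [W.form_monicOP_of_ne hj, mul_zero])
    (fun h => absurd hi h)] at h
  exact (W.isUnit_form_monicOP i).mul_left_eq_zero.1 h

/-- The operator with prescribed eigenvalues on the monic orthogonal polynomials. -/
lemma exists_act_monicOP_eq (B : ℕ → Mat N) :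
    ∃ L : RightOp N, ∀ n, act (W.monicOP n) L = B n • W.monicOP n := by
  let b : Module.Basis ℕ (Mat N) (MatPoly N) := Module.Basis.mk W.linearIndependent_monicOP
    fun Q _ => mem_span_range W.natDegree_monicOP_le W.coeff_monicOP_self Q
  refine ⟨MulOpposite.op (b.constr ℕ fun n => B n • W.monicOP n), fun n => ?_⟩
  have hb : W.monicOP n = b n := (Module.Basis.mk_apply _ _ n).symm
  rw [act, MulOpposite.unop_op]
  nth_rewrite 1 [hb]
  rw [Module.Basis.constr_basis]

lemma isAdjoint_of_monicOP {L L' : RightOp N}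
    (h : ∀ n m, W.form (act (W.monicOP n) L) (W.monicOP m) =
      W.form (W.monicOP n) (act (W.monicOP m) L')) : W.IsAdjoint L L' := by
  intro P Q
  have hP := mem_span_range W.natDegree_monicOP_le W.coeff_monicOP_self P
  have hQ := mem_span_range W.natDegree_monicOP_le W.coeff_monicOP_self Q
  induction hP using Submodule.span_induction with
  | mem x hx =>
    obtain ⟨n, rfl⟩ := hx
    induction hQ using Submodule.span_induction with
    | mem y hy => obtain ⟨m, rfl⟩ := hy; exact h n m
    | zero => rw [act_zero_left, form_zero_right, form_zero_right]
    | add x y _ _ hx hy => rw [act_add_left, form_add_right, form_add_right, hx, hy]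
    | smul A x _ hx => rw [act_smul, form_smul_right, form_smul_right, hx]
  | zero => rw [act_zero_left, form_zero_left, form_zero_left]
  | add x y _ _ hx hy => rw [act_add_left, form_add_left, form_add_left, hx, hy]
  | smul A x _ hx => rw [act_smul, form_smul_left, form_smul_left, hx]

/-- `𝒟(W)` is closed under adjoints. -/
theorem exists_adjoint (D : W.diffAlgebra) : ∃ D' : W.diffAlgebra, ∀ n,
    W.eigenHom D' n * W.form (W.monicOP n) (W.monicOP n) =
      W.form (W.monicOP n) (W.monicOP n) * (W.eigenHom D n)ᴴ := by
  choose u hu using W.isUnit_form_monicOP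
  have hherm : ∀ n, ((u n : Mat N))ᴴ = u n := fun n => by rw [hu, form_conj]
  obtain ⟨L, hL⟩ := W.exists_act_monicOP_eq fun n =>
    u n * (W.eigenHom D n)ᴴ * (↑(u n)⁻¹ : Mat N)
  have hadj : W.IsAdjoint D L := by
    refine W.isAdjoint_of_monicOP fun n m => ?_
    rw [act_monicOP, hL, form_smul_left, form_smul_right]
    by_cases hnm : n = m
    · subst hnm
      have hinv : ((↑(u n)⁻¹ : Mat N))ᴴ = ↑(u n)⁻¹ := by
        rw [Matrix.coe_units_inv, Matrix.conjTranspose_nonsing_inv, hherm]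
      rw [← hu, Matrix.conjTranspose_mul, Matrix.conjTranspose_mul, hherm, hinv,
        Matrix.conjTranspose_conjTranspose, ← mul_assoc, Units.mul_inv, one_mul]
    · rw [W.form_monicOP_of_ne hnm, mul_zero, zero_mul]
  refine ⟨⟨L, hadj.isDiffOp D.2.1, fun n => ⟨_, hL n⟩⟩, fun n => ?_⟩
  rw [W.eigenHom_eq_of_act (hL n), ← hu, mul_assoc, Units.inv_mul, mul_one]

end WeightMatrix
end MatrixBochner

end

noncomputable section

namespace MatrixBochner

/-! ### Central multiples in algebras of matrix sequences -/

variable {N : ℕ}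

section Blocks

variable {R : Type*} [CommRing R]

/-- The rows of `M` indexed by `S`, completed by the rows of the identity matrix. -/
def rowBlock (S : Fin N → Prop) [DecidablePred S] (M : Matrix (Fin N) (Fin N) R) :
    Matrix (Fin N) (Fin N) R :=
  Matrix.of fun i j => if S i then M i j else (1 : Matrix (Fin N) (Fin N) R) i j

variable {S : Fin N → Prop} [DecidablePred S] {M : Matrix (Fin N) (Fin N) R}

lemma rowBlock_pow_apply (hM : ∀ i j, M i j ≠ 0 → (S i ↔ S j)) (k : ℕ) {i : Fin N} (hi : S i)
    (j : Fin N) : (rowBlock S M ^ k) i j = (M ^ k) i j := by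
  induction k generalizing i with
  | zero => simp
  | succ k ih =>
    rw [pow_succ', pow_succ', Matrix.mul_apply, Matrix.mul_apply]
    refine Finset.sum_congr rfl fun l _ => ?_
    rw [rowBlock, Matrix.of_apply, if_pos hi]
    by_cases h : M i l = 0
    · rw [h, zero_mul, zero_mul]
    · rw [← ih ((hM i l h).1 hi), rowBlock]

lemma det_rowBlock_ne_zero [IsDomain R] (hM : ∀ i j, M i j ≠ 0 → (S i ↔ S j)) (h : M.det ≠ 0) :
    (rowBlock S M).det ≠ 0 := by
  intro h0
  obtain ⟨v, hv, hv0⟩ := Matrix.exists_mulVec_eq_zero_iff.2 h0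
  refine h (Matrix.exists_mulVec_eq_zero_iff.1 ⟨v, hv, ?_⟩)
  have hout : ∀ i, ¬ S i → v i = 0 := by
    intro i hi
    have := congrFun hv0 i
    simpa [rowBlock, Matrix.mulVec, dotProduct, hi, Matrix.one_apply] using this
  funext i
  by_cases hi : S i
  · have := congrFun hv0 i
    simpa [rowBlock, Matrix.mulVec, dotProduct, hi] using this
  · rw [Matrix.mulVec, dotProduct, Pi.zero_apply]
    refine Finset.sum_eq_zero fun j _ => ?_
    by_cases hij : M i j = 0
    · rw [hij, zero_mul]
    · rw [hout j (fun hj => hi ((hM i j hij).2 hj)), mul_zero]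

end Blocks

lemma charpoly_eq_of_mul_diagonal {M R : Mat N} {g : Fin N → ℂ} (hg : ∀ i, g i ≠ 0)
    (h : ∀ i j, M i j * g j = g i * R i j) : M.charpoly = R.charpoly := by
  have hdet : IsUnit (Matrix.diagonal g) := by
    rw [Matrix.isUnit_iff_isUnit_det, Matrix.det_diagonal, isUnit_iff_ne_zero]
    exact Finset.prod_ne_zero_iff.2 fun i _ => hg i
  obtain ⟨u, hu⟩ := hdet
  have h' : M * u = u * R := by
    rw [hu]
    ext i j
    rw [Matrix.mul_diagonal, Matrix.diagonal_mul, h]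
  have h'' : M = u.val * R * u⁻¹.val := by rw [← h', mul_assoc, Units.mul_inv, mul_one]
  rw [h'', Matrix.coe_units_inv, Matrix.charpoly_units_conj]

lemma isUnit_of_mul_eq_diagonal {M E : Mat N} {d : Fin N → ℂ} (hd : ∀ i, d i ≠ 0)
    (h : M * E = Matrix.diagonal d) : IsUnit E := by
  rw [Matrix.isUnit_iff_isUnit_det, isUnit_iff_ne_zero]
  intro h0
  have := congrArg Matrix.det h
  rw [Matrix.det_mul, h0, mul_zero, Matrix.det_diagonal] at this
  exact Finset.prod_ne_zero_iff.2 (fun i _ => hd i) this.symm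

section Central

variable {A : Type*} [Semiring A] [Algebra ℂ A] (φ : A →ₐ[ℂ] (ℕ → Mat N))
  (μ : Fin N → ℕ → ℂ) (Δ : A) (e : Fin N → A)

/-- The element with eigenvalues `diag (f_i (μ_i))`. -/
def diagElement (f : Fin N → ℂ[X]) : A := ∑ i, e i * aeval Δ (f i)

variable {φ μ Δ e}

lemma map_aeval_diagonal (hΔ : ∀ n, φ Δ n = Matrix.diagonal fun i => μ i n) (q : ℂ[X]) (n : ℕ) :
    φ (aeval Δ q) n = Matrix.diagonal fun i => q.eval (μ i n) := by
  induction q using Polynomial.induction_on' with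
  | add p q hp hq =>
    rw [map_add, map_add, Pi.add_apply, hp, hq, Matrix.diagonal_add]
    simp only [eval_add]
  | monomial k a =>
    rw [aeval_monomial, map_mul, map_pow, AlgHom.commutes, Pi.mul_apply, Pi.pow_apply, hΔ,
      Pi.algebraMap_apply, Matrix.diagonal_pow, ← Algebra.smul_def, ← Matrix.diagonal_smul]
    congr 1
    funext i
    simp

lemma map_diagElement (hΔ : ∀ n, φ Δ n = Matrix.diagonal fun i => μ i n)
    (he : ∀ i n, φ (e i) n = Matrix.diagonal (Pi.single i 1)) (f : Fin N → ℂ[X]) (n : ℕ) :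
    φ (diagElement Δ e f) n = Matrix.diagonal fun i => (f i).eval (μ i n) := by
  rw [diagElement, map_sum, Finset.sum_apply]
  simp only [map_mul, Pi.mul_apply, he, map_aeval_diagonal hΔ, Matrix.diagonal_mul_diagonal]
  ext i j
  rw [Matrix.sum_apply]
  by_cases hij : i = j
  · subst hij
    simp [Pi.single_apply]
  · simp [Matrix.diagonal_apply_ne _ hij]

lemma diagElement_mem_center (hφ : Function.Injective φ)
    (hΔ : ∀ n, φ Δ n = Matrix.diagonal fun i => μ i n)
    (he : ∀ i n, φ (e i) n = Matrix.diagonal (Pi.single i 1))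
    (hμ : ∀ D n i j, φ D n i j ≠ 0 → μ i = μ j) {f : Fin N → ℂ[X]}
    (hf : ∀ i j, μ i = μ j → f i = f j) : diagElement Δ e f ∈ Subalgebra.center ℂ A := by
  rw [Subalgebra.mem_center_iff]
  intro D
  apply hφ
  funext n
  ext i j
  rw [map_mul, map_mul, Pi.mul_apply, Pi.mul_apply, map_diagElement hΔ he, Matrix.mul_diagonal,
    Matrix.diagonal_mul]
  by_cases h : φ D n i j = 0
  · rw [h, zero_mul, mul_zero]
  · have h' := hμ D n i j h
    rw [hf i j h', h', mul_comm]

/-- In an algebra of sequences of matrices whose entries are, up to conjugation by a diagonal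
matrix, polynomials in the eigenvalues `μ_i`, every element that is invertible at each index
divides a central element with the same property. -/
theorem exists_mul_mem_center (hφ : Function.Injective φ)
    (hΔ : ∀ n, φ Δ n = Matrix.diagonal fun i => μ i n)
    (he : ∀ i n, φ (e i) n = Matrix.diagonal (Pi.single i 1))
    (hμ : ∀ D n i j, φ D n i j ≠ 0 → μ i = μ j)
    {g : ℕ → Fin N → ℂ} (hg : ∀ n i, g n i ≠ 0)
    (D : A) (hR : ∃ R : Matrix (Fin N) (Fin N) ℂ[X], ∀ n i j,
      φ D n i j * g n j = g n i * (R i j).eval (μ i n))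
    (hD : ∀ n, IsUnit (φ D n)) :
    ∃ E : A, D * E ∈ Subalgebra.center ℂ A ∧ ∀ n, IsUnit (φ E n) := by
  classical
  obtain ⟨R, hR⟩ := hR
  let f : ℕ → Fin N → ℂ[X] := fun k i => (rowBlock (fun j => μ j = μ i) R).charpoly.coeff k
  have hf : ∀ k i j, μ i = μ j → f k i = f k j := fun k i j h =>
    congrArg (fun m => (rowBlock (fun l => μ l = m) R).charpoly.coeff k) h
  have hblock : ∀ n i a b, φ D n a b ≠ 0 → (μ a = μ i ↔ μ b = μ i) := fun n i a b h => by
    rw [hμ D n a b h]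
  have hcoeff : ∀ k i n, (f k i).eval (μ i n) =
      (rowBlock (fun j => μ j = μ i) (φ D n)).charpoly.coeff k := by
    intro k i n
    rw [charpoly_eq_of_mul_diagonal (hg n)
      (R := (rowBlock (fun j => μ j = μ i) R).map (evalRingHom (μ i n))), Matrix.charpoly_map,
      coeff_map]
    · rfl
    · intro a b
      by_cases ha : μ a = μ i
      · simp only [rowBlock, Matrix.of_apply, ha, if_true, Matrix.map_apply, coe_evalRingHom]
        rw [hR, ha]
      · simp only [rowBlock, Matrix.of_apply, ha, if_false, Matrix.map_apply, coe_evalRingHom]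
        by_cases hab : a = b
        · subst hab
          simp
        · simp [Matrix.one_apply_ne hab]
  have hz : ∀ k, diagElement Δ e (f k) ∈ Subalgebra.center ℂ A := fun k =>
    diagElement_mem_center hφ hΔ he hμ (hf k)
  have hCH : ∑ k ∈ Finset.range (N + 1), diagElement Δ e (f k) * D ^ k = 0 := by
    apply hφ
    funext n
    ext i j
    have h := congrFun (congrFun
      (Matrix.aeval_self_charpoly (rowBlock (fun j => μ j = μ i) (φ D n))) i) j
    rw [aeval_eq_sum_range' (n := N + 1) (by rw [Matrix.charpoly_natDegree_eq_dim]; simp),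
      Matrix.sum_apply] at h
    rw [map_sum, Finset.sum_apply, Matrix.sum_apply, map_zero]
    refine Eq.trans (Finset.sum_congr rfl fun k _ => ?_) h
    rw [map_mul, map_pow, Pi.mul_apply, Pi.pow_apply, map_diagElement hΔ he, Matrix.diagonal_mul,
      hcoeff, Matrix.smul_apply, smul_eq_mul, rowBlock_pow_apply (hblock n i) k rfl]
  let E : A := ∑ k ∈ Finset.range N, diagElement Δ e (f (k + 1)) * D ^ k
  have hsum : D * E + diagElement Δ e (f 0) = 0 := by
    rw [Finset.sum_range_succ', pow_zero, mul_one] at hCH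
    rw [← hCH, Finset.mul_sum]
    congr 1
    refine Finset.sum_congr rfl fun k _ => ?_
    rw [← mul_assoc, Subalgebra.mem_center_iff.1 (hz (k + 1)), mul_assoc, ← pow_succ']
  have h : ∀ n, φ (D * E) n = Matrix.diagonal fun i => -(f 0 i).eval (μ i n) := by
    intro n
    have := congrFun (congrArg φ hsum) n
    rw [map_add, map_zero, Pi.add_apply, map_diagElement hΔ he, Pi.zero_apply] at this
    rw [eq_neg_of_add_eq_zero_left this, Matrix.diagonal_neg]
  have hDE : D * E = diagElement Δ e fun i => -f 0 i := by
    apply hφ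
    funext n
    rw [h, map_diagElement hΔ he]
    simp only [eval_neg]
  refine ⟨E, hDE ▸ diagElement_mem_center hφ hΔ he hμ fun i j hij => by rw [hf 0 i j hij],
    fun n => ?_⟩
  have h := h n
  rw [map_mul, Pi.mul_apply] at h
  refine isUnit_of_mul_eq_diagonal (fun i => neg_ne_zero.2 fun h0 => ?_) h
  rw [hcoeff] at h0
  refine det_rowBlock_ne_zero (hblock n i) ?_ (by rw [Matrix.det_eq_sign_charpoly_coeff, h0,
    mul_zero])
  exact ((Matrix.isUnit_iff_isUnit_det _).1 (hD n)).ne_zero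

end Central

end MatrixBochner

end

noncomputable section

namespace MatrixBochner

/-! ### The second order operators of the classical weights -/

/-- The leading coefficient `a` of the second order operator `a ∂² + b ∂` of the classical
weights of a given type. -/
def ClassicalType.leadCoeff : ClassicalType → ℝ[X]
  | .hermite => C (-1 / 2)
  | .laguerre => -X
  | .jacobi => X ^ 2 - 1

lemma ClassicalType.measurableSet_support (t : ClassicalType) : MeasurableSet t.support := by
  cases t
  exacts [MeasurableSet.univ, measurableSet_Ioi, measurableSet_Ioo]

namespace ClassicalWeight

variable {t : ClassicalType}

/-- The first order coefficient `b` of the second order operator `a ∂² + b ∂` of a classical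
weight. -/
def driftCoeff : {t : ClassicalType} → ClassicalWeight t → ℝ[X]
  | _, .hermite b => X - C b
  | _, .laguerre α _ => X - C (α + 1)
  | _, .jacobi α β _ _ => C (α + β + 2) * X + C (α - β)

/-- The function `a w`, extended by zero to the finite end points of the support. -/
def leadFun : {t : ClassicalType} → ClassicalWeight t → ℝ → ℝ
  | _, .hermite b, x => -1 / 2 * Real.exp (-x ^ 2 + 2 * b * x)
  | _, .laguerre α _, x => -(Real.exp (-x) * x ^ (α + 1))
  | _, .jacobi α β _ _, x => -((1 - x) ^ (α + 1) * (1 + x) ^ (β + 1))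

lemma leadFun_eq (w : ClassicalWeight t) {x : ℝ} (hx : x ∈ t.support) :
    w.leadFun x = t.leadCoeff.eval x * w.toFun x := by
  cases w with
  | hermite b => simp [leadFun, ClassicalType.leadCoeff, toFun]
  | laguerre α hα =>
    have hx' : (0 : ℝ) < x := hx
    simp only [leadFun, ClassicalType.leadCoeff, toFun, eval_neg, eval_X]
    rw [Real.rpow_add_one hx'.ne']
    ring
  | jacobi α β hα hβ =>
    have h1 : 1 - x ≠ 0 := by have := hx.2; linarith
    have h2 : 1 + x ≠ 0 := by have := hx.1; linarith
    simp only [leadFun, ClassicalType.leadCoeff, toFun, eval_sub, eval_pow, eval_X, eval_one]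
    rw [Real.rpow_add_one h1, Real.rpow_add_one h2]
    ring

/-- The Pearson equation `(a w)' = b w`. -/
lemma hasDerivAt_leadFun (w : ClassicalWeight t) {x : ℝ} (hx : x ∈ t.support) :
    HasDerivAt w.leadFun (w.driftCoeff.eval x * w.toFun x) x := by
  cases w with
  | hermite b =>
    have h1 : HasDerivAt (fun x : ℝ => -x ^ 2 + 2 * b * x) (-(2 * x) + 2 * b) x := by
      refine (((hasDerivAt_pow 2 x).neg).add ((hasDerivAt_id x).const_mul (2 * b))).congr_deriv ?_
      simp
    have h := (h1.exp).const_mul (-1 / 2)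
    refine h.congr_deriv ?_
    simp only [driftCoeff, toFun, eval_sub, eval_X, eval_C]
    ring
  | laguerre α hα =>
    have hx' : (0 : ℝ) < x := hx
    have h1 : HasDerivAt (fun x : ℝ => Real.exp (-x)) (-Real.exp (-x)) x := by
      simpa using (hasDerivAt_id x).neg.exp
    have h2 := Real.hasDerivAt_rpow_const (x := x) (p := α + 1) (Or.inl hx'.ne')
    refine ((h1.mul h2).neg).congr_deriv ?_
    simp only [driftCoeff, toFun, eval_sub, eval_X, eval_C, add_sub_cancel_right]
    rw [Real.rpow_add_one hx'.ne']
    ring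
  | jacobi α β hα hβ =>
    have hx1 : 1 - x ≠ 0 := by have := hx.2; linarith
    have hx2 : 1 + x ≠ 0 := by have := hx.1; linarith
    have h1 : HasDerivAt (fun x : ℝ => (1 - x) ^ (α + 1)) (-1 * (α + 1) * (1 - x) ^ α) x := by
      simpa using ((hasDerivAt_id x).const_sub 1).rpow_const (p := α + 1) (Or.inl hx1)
    have h2 : HasDerivAt (fun x : ℝ => (1 + x) ^ (β + 1)) (1 * (β + 1) * (1 + x) ^ β) x := by
      simpa using ((hasDerivAt_id x).const_add 1).rpow_const (p := β + 1) (Or.inl hx2)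
    refine ((h1.mul h2).neg).congr_deriv ?_
    simp only [driftCoeff, toFun, eval_add, eval_mul, eval_X, eval_C]
    rw [Real.rpow_add_one hx1, Real.rpow_add_one hx2]
    ring

lemma integrableOn_eval_mul (w : ClassicalWeight t) (q : ℂ[X]) :
    IntegrableOn (fun x : ℝ => q.eval (x : ℂ) * (w.toFun x : ℂ)) t.support := by
  induction q using Polynomial.induction_on' with
  | add p q hp hq =>
    simp only [eval_add, add_mul]
    exact hp.add hq
  | monomial k c =>
    have h : IntegrableOn (fun x : ℝ => ((x ^ k * w.toFun x : ℝ) : ℂ)) t.support :=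
      (w.moments k).ofReal
    refine (h.const_mul c).congr (Filter.Eventually.of_forall fun x => ?_)
    simp only [eval_monomial]
    push_cast
    ring

lemma hasDerivAt_eval_ofReal (u : ℂ[X]) (x : ℝ) :
    HasDerivAt (fun x : ℝ => u.eval (x : ℂ)) ((derivative u).eval (x : ℂ)) x := by
  have := (u.hasDerivAt (x : ℂ)).comp_ofReal
  exact this

lemma hasDerivAt_eval_mul_leadFun (w : ClassicalWeight t) (u : ℂ[X]) {x : ℝ}
    (hx : x ∈ t.support) : HasDerivAt (fun x : ℝ => u.eval (x : ℂ) * (w.leadFun x : ℂ))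
      ((derivative u * t.leadCoeff.map Complex.ofRealHom +
        u * w.driftCoeff.map Complex.ofRealHom).eval (x : ℂ) * (w.toFun x : ℂ)) x := by
  refine ((hasDerivAt_eval_ofReal u x).mul (w.hasDerivAt_leadFun hx).ofReal_comp).congr_deriv ?_
  have hA : (t.leadCoeff.map Complex.ofRealHom).eval (x : ℂ) = (t.leadCoeff.eval x : ℝ) :=
    eval_map_apply Complex.ofRealHom x
  have hB : (w.driftCoeff.map Complex.ofRealHom).eval (x : ℂ) = (w.driftCoeff.eval x : ℝ) :=
    eval_map_apply Complex.ofRealHom x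
  rw [eval_add, eval_mul, eval_mul, hA, hB, w.leadFun_eq hx]
  push_cast
  ring

lemma integral_pearson (w : ClassicalWeight t) (u : ℂ[X]) :
    ∫ x in t.support, (derivative u * t.leadCoeff.map Complex.ofRealHom +
      u * w.driftCoeff.map Complex.ofRealHom).eval (x : ℂ) * (w.toFun x : ℂ) = 0 := by
  have hint := w.integrableOn_eval_mul (derivative u * t.leadCoeff.map Complex.ofRealHom +
      u * w.driftCoeff.map Complex.ofRealHom)
  have hderiv := fun x (hx : x ∈ t.support) => w.hasDerivAt_eval_mul_leadFun u hx
  have hint' : IntegrableOn (fun x : ℝ => u.eval (x : ℂ) * (w.leadFun x : ℂ)) t.support := by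
    refine (w.integrableOn_eval_mul (u * t.leadCoeff.map Complex.ofRealHom)).congr_fun
      (fun x hx => ?_) t.measurableSet_support
    have hA : (t.leadCoeff.map Complex.ofRealHom).eval (x : ℂ) = (t.leadCoeff.eval x : ℝ) :=
      eval_map_apply Complex.ofRealHom x
    simp only [eval_mul, hA, w.leadFun_eq hx]
    push_cast
    ring
  have hu : Continuous fun x : ℝ => u.eval (x : ℂ) := u.continuous.comp Complex.continuous_ofReal
  cases t with
  | hermite =>
    rw [ClassicalType.support, setIntegral_univ]
    exact integral_eq_zero_of_hasDerivAt_of_integrable (fun x => hderiv x (Set.mem_univ x))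
      (by simpa [ClassicalType.support] using hint) (by simpa [ClassicalType.support] using hint')
  | laguerre =>
    have h0 : ContinuousWithinAt (fun x : ℝ => u.eval (x : ℂ) * (w.leadFun x : ℂ))
        (Set.Ici 0) 0 := by
      cases w with
      | laguerre α hα =>
        refine (hu.continuousAt.mul (Complex.continuous_ofReal.continuousAt.comp ?_)).continuousWithinAt
        refine ContinuousAt.neg (ContinuousAt.mul (by fun_prop) ?_)
        exact Real.continuousAt_rpow_const _ _ (Or.inr (by linarith))
    have hlim := tendsto_zero_of_hasDerivAt_of_integrableOn_Ioi hderiv hint hint'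
    refine (integral_Ioi_of_hasDerivAt_of_tendsto h0 hderiv hint hlim).trans ?_
    cases w with
    | laguerre α hα => simp [leadFun, Real.zero_rpow (show α + 1 ≠ 0 by linarith)]
  | jacobi =>
    have hle : (-1 : ℝ) ≤ 1 := by norm_num
    have hc : ContinuousOn (fun x : ℝ => u.eval (x : ℂ) * (w.leadFun x : ℂ)) (Set.Icc (-1) 1) := by
      cases w with
      | jacobi α β hα hβ =>
        refine (hu.mul (Complex.continuous_ofReal.comp (Continuous.neg (Continuous.mul ?_ ?_)))).continuousOn
        · exact (continuous_const.sub continuous_id).rpow_const fun x => Or.inr (by linarith)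
        · exact (continuous_const.add continuous_id).rpow_const fun x => Or.inr (by linarith)
    have h := intervalIntegral.integral_eq_sub_of_hasDerivAt_of_le hle hc hderiv
      ((intervalIntegrable_iff_integrableOn_Ioo_of_le hle).2 hint)
    rw [intervalIntegral.integral_of_le hle, integral_Ioc_eq_integral_Ioo] at h
    refine h.trans ?_
    cases w with
    | jacobi α β hα hβ => simp [leadFun, Real.zero_rpow (show α + 1 ≠ 0 by linarith),
        Real.zero_rpow (show β + 1 ≠ 0 by linarith)]

/-- The second order operator `a ∂² + b ∂` is symmetric for the bilinear form of the weight. -/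
lemma integral_secondOrder_symm (w : ClassicalWeight t) (p q : ℂ[X]) :
    ∫ x in t.support, ((derivative (derivative p) * t.leadCoeff.map Complex.ofRealHom +
        derivative p * w.driftCoeff.map Complex.ofRealHom) * q).eval (x : ℂ) * (w.toFun x : ℂ) =
      ∫ x in t.support, (p * (derivative (derivative q) * t.leadCoeff.map Complex.ofRealHom +
        derivative q * w.driftCoeff.map Complex.ofRealHom)).eval (x : ℂ) * (w.toFun x : ℂ) := by
  rw [← sub_eq_zero, ← integral_sub (w.integrableOn_eval_mul _) (w.integrableOn_eval_mul _),
    ← w.integral_pearson (derivative p * q - p * derivative q)]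
  refine integral_congr_ae (Filter.Eventually.of_forall fun x => ?_)
  simp only [← sub_mul, ← eval_sub]
  congr 2
  simp only [derivative_sub, derivative_mul]
  ring

end ClassicalWeight
end MatrixBochner

end

noncomputable section

namespace MatrixBochner

/-! ### Entries of matrix polynomials -/

variable {N : ℕ}

/-- The entry of a matrix polynomial, as a scalar polynomial. -/
def entry (P : MatPoly N) (i j : Fin N) : ℂ[X] := matPolyEquiv.symm P i j

lemma coeff_entry (P : MatPoly N) (i j : Fin N) (k : ℕ) :
    (entry P i j).coeff k = P.coeff k i j := by
  conv_rhs => rw [← matPolyEquiv.apply_symm_apply P, matPolyEquiv_coeff_apply]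
  rfl

lemma evalReal_apply (P : MatPoly N) (x : ℝ) (i j : Fin N) :
    evalReal P x i j = (entry P i j).eval (x : ℂ) := by
  have := matPolyEquiv_eval (matPolyEquiv.symm P) (x : ℂ) i j
  rw [AlgEquiv.apply_symm_apply] at this
  exact this

lemma entry_add (P Q : MatPoly N) (i j : Fin N) : entry (P + Q) i j = entry P i j + entry Q i j := by
  ext k
  simp [coeff_entry]

lemma entry_zero (i j : Fin N) : entry (0 : MatPoly N) i j = 0 := by
  ext k
  simp [coeff_entry]

lemma entry_sum {ι : Type*} (s : Finset ι) (P : ι → MatPoly N) (i j : Fin N) :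
    entry (∑ k ∈ s, P k) i j = ∑ k ∈ s, entry (P k) i j := by
  classical
  induction s using Finset.induction_on with
  | empty => simp [entry_zero]
  | insert a s ha ih => rw [Finset.sum_insert ha, Finset.sum_insert ha, entry_add, ih]

lemma entry_mul (P Q : MatPoly N) (i j : Fin N) :
    entry (P * Q) i j = ∑ k, entry P i k * entry Q k j := by
  rw [entry, map_mul, Matrix.mul_apply]
  rfl

lemma entry_derivative (P : MatPoly N) (i j : Fin N) :
    entry (derivative P) i j = derivative (entry P i j) := by
  ext k
  rw [coeff_entry, coeff_derivative, coeff_derivative, coeff_entry]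
  have : ((k : Mat N) + 1) = algebraMap ℂ (Mat N) (k + 1) := by simp
  rw [this, ← Algebra.commutes, ← Algebra.smul_def, Matrix.smul_apply, smul_eq_mul, mul_comm]

lemma entry_iterate_derivative (P : MatPoly N) (m : ℕ) (i j : Fin N) :
    entry (derivative^[m] P) i j = derivative^[m] (entry P i j) := by
  induction m generalizing P with
  | zero => rfl
  | succ m ih => rw [Function.iterate_succ_apply, ih, entry_derivative, Function.iterate_succ_apply]

/-- The diagonal matrix polynomial with given entries. -/
def diagPoly (f : Fin N → ℂ[X]) : MatPoly N := matPolyEquiv (Matrix.diagonal f)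

lemma entry_diagPoly (f : Fin N → ℂ[X]) (i j : Fin N) :
    entry (diagPoly f) i j = Matrix.diagonal f i j := by
  rw [entry, diagPoly, AlgEquiv.symm_apply_apply]

lemma entry_mul_diagPoly (P : MatPoly N) (f : Fin N → ℂ[X]) (i j : Fin N) :
    entry (P * diagPoly f) i j = entry P i j * f j := by
  rw [entry_mul, Finset.sum_eq_single j]
  · rw [entry_diagPoly, Matrix.diagonal_apply_eq]
  · intro k _ hk
    rw [entry_diagPoly, Matrix.diagonal_apply_ne _ hk, mul_zero]
  · simp

lemma entry_diagonal_smul (d : Fin N → ℂ) (P : MatPoly N) (i j : Fin N) :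
    entry (Matrix.diagonal d • P) i j = C (d i) * entry P i j := by
  ext k
  rw [coeff_entry, coeff_smul, coeff_C_mul, coeff_entry, smul_eq_mul, Matrix.diagonal_mul]

lemma natDegree_entry_le {P : MatPoly N} {n : ℕ} (h : P.natDegree ≤ n) (i j : Fin N) :
    (entry P i j).natDegree ≤ n := by
  rw [natDegree_le_iff_coeff_eq_zero]
  intro m hm
  rw [coeff_entry, coeff_eq_zero_of_natDegree_lt (h.trans_lt hm), Matrix.zero_apply]

/-! ### Diagonal weights -/

variable {t : ClassicalType} (w : Fin N → ClassicalWeight t)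

lemma eval_map_conj (q : ℂ[X]) (x : ℝ) :
    (q.map (starRingEnd ℂ)).eval (x : ℂ) = star (q.eval (x : ℂ)) := by
  have := eval_map_apply (p := q) (starRingEnd ℂ) (x : ℂ)
  rwa [Complex.conj_ofReal] at this

lemma form_directSum (P Q : MatPoly N) (i j : Fin N) :
    (directSum w).form P Q i j = ∑ k, ∫ x in t.support,
      (entry P i k * (entry Q j k).map (starRingEnd ℂ)).eval (x : ℂ) * ((w k).toFun x : ℂ) := by
  rw [← integral_finsetSum _ fun k _ => (w k).integrableOn_eval_mul _]
  rw [WeightMatrix.form, Matrix.of_apply]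
  refine integral_congr_ae (Filter.Eventually.of_forall fun x => ?_)
  simp only [directSum]
  rw [Matrix.mul_apply]
  refine Finset.sum_congr rfl fun k _ => ?_
  rw [Matrix.mul_diagonal, Matrix.conjTranspose_apply, evalReal_apply, evalReal_apply, eval_mul,
    eval_map_conj]
  ring

lemma isAdjoint_of_entry {L : RightOp N} (T : Fin N → ℂ[X] → ℂ[X])
    (hL : ∀ P i k, entry (act P L) i k = T k (entry P i k))
    (hT : ∀ k p q, ∫ x in t.support, (T k p * q.map (starRingEnd ℂ)).eval (x : ℂ) *
        ((w k).toFun x : ℂ) =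
      ∫ x in t.support, (p * (T k q).map (starRingEnd ℂ)).eval (x : ℂ) * ((w k).toFun x : ℂ)) :
    (directSum w).IsAdjoint L L := by
  intro P Q
  ext i j
  rw [form_directSum, form_directSum]
  refine Finset.sum_congr rfl fun k _ => ?_
  rw [hL, hL, hT]

/-- Right multiplication by the projection onto the `i`-th coordinate. -/
def coordProj (i : Fin N) : RightOp N := monoOp 0 (diagPoly (Pi.single i 1))

lemma entry_act_coordProj (i : Fin N) (P : MatPoly N) (r k : Fin N) :
    entry (act P (coordProj i)) r k = entry P r k * (Pi.single i 1 : Fin N → ℂ[X]) k := by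
  rw [coordProj, act_monoOp_zero, entry_mul_diagPoly]

lemma coordProj_mem (i : Fin N) : coordProj i ∈ (directSum w).diffAlgebra := by
  have hdeg : IsDegreeNonraising (coordProj i) := by
    intro P
    rw [degree_le_iff_coeff_zero]
    intro m hm
    ext r k
    rw [← coeff_entry, entry_act_coordProj, Pi.single_apply]
    split_ifs
    · rw [mul_one, coeff_entry, coeff_eq_zero_of_degree_lt hm]
    · simp
  refine (isAdjoint_of_entry w (fun k p => p * (Pi.single i 1 : Fin N → ℂ[X]) k)
    (entry_act_coordProj i) fun k p q => ?_).mem_diffAlgebra (isDiffOp_monoOp _ _) hdeg hdeg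
  have : ((Pi.single i 1 : Fin N → ℂ[X]) k).map (starRingEnd ℂ) = (Pi.single i 1 : Fin N → ℂ[X]) k := by
    rw [Pi.single_apply]
    split_ifs <;> simp
  rw [Polynomial.map_mul, this]
  congr! 4
  ring

lemma eigenHom_coordProj (i : Fin N) (n : ℕ) :
    (directSum w).eigenHom ⟨coordProj i, coordProj_mem w i⟩ n = Matrix.diagonal (Pi.single i 1) := by
  ext r k
  rw [WeightMatrix.eigenHom_apply, ← coeff_entry, entry_act_coordProj, Pi.single_apply]
  by_cases hk : k = i
  · subst hk
    rw [if_pos rfl, mul_one, coeff_entry, WeightMatrix.coeff_monicOP_self, Matrix.one_apply,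
      Matrix.diagonal_apply]
    split_ifs with h
    · simp [h]
    · rfl
  · rw [if_neg hk, mul_zero, coeff_zero, Matrix.diagonal_apply]
    split_ifs with h
    · subst h
      simp [hk]
    · rfl

lemma entry_monicOP_of_ne {n : ℕ} {r k : Fin N} (h : r ≠ k) :
    entry ((directSum w).monicOP n) r k = 0 := by
  have := (directSum w).act_monicOP ⟨coordProj k, coordProj_mem w k⟩ n
  rw [eigenHom_coordProj] at this
  have h2 := congrArg (fun P => entry P r k) this
  simpa [entry_act_coordProj, entry_diagonal_smul, h] using h2

/-- The monic orthogonal polynomials of the scalar weights. -/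
def scalarOP (n : ℕ) (i : Fin N) : ℂ[X] := entry ((directSum w).monicOP n) i i

lemma coeff_scalarOP_self (n : ℕ) (i : Fin N) : (scalarOP w n i).coeff n = 1 := by
  rw [scalarOP, coeff_entry, WeightMatrix.coeff_monicOP_self, Matrix.one_apply_eq]

lemma scalarOP_ne_zero (n : ℕ) (i : Fin N) : scalarOP w n i ≠ 0 := by
  intro h
  have := coeff_scalarOP_self w n i
  simp [h] at this

lemma natDegree_scalarOP_le (n : ℕ) (i : Fin N) : (scalarOP w n i).natDegree ≤ n :=
  natDegree_entry_le ((directSum w).natDegree_monicOP_le n) i i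

lemma entry_smul_monicOP (A : Mat N) (n : ℕ) (i j : Fin N) :
    entry (A • (directSum w).monicOP n) i j = C (A i j) * scalarOP w n j := by
  ext k
  rw [coeff_entry, coeff_smul, coeff_C_mul, scalarOP, coeff_entry, smul_eq_mul, Matrix.mul_apply,
    Finset.sum_eq_single j]
  · intro l _ hl
    rw [← coeff_entry, entry_monicOP_of_ne w hl, coeff_zero, mul_zero]
  · simp

lemma entry_act_monicOP (m : ℕ) (F : ℕ → MatPoly N) (n : ℕ) (i j : Fin N) :
    entry (act ((directSum w).monicOP n) (diffOp m F)) i j =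
      ∑ k ∈ Finset.range (m + 1), derivative^[k] (scalarOP w n i) * entry (F k) i j := by
  rw [act_diffOp, entry_sum]
  refine Finset.sum_congr rfl fun k _ => ?_
  rw [entry_mul, Finset.sum_eq_single i]
  · rw [entry_iterate_derivative, scalarOP]
  · intro l _ hl
    rw [entry_iterate_derivative, entry_monicOP_of_ne w hl.symm, iterate_derivative_zero, zero_mul]
  · simp

/-- The scalar form of `P_n · D = Λ_n P_n` for a diagonal weight. -/
lemma sum_iterate_derivative_scalarOP (D : (directSum w).diffAlgebra) {m : ℕ} {F : ℕ → MatPoly N}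
    (hF : (D : RightOp N) = diffOp m F) (n : ℕ) (i j : Fin N) :
    ∑ k ∈ Finset.range (m + 1), derivative^[k] (scalarOP w n i) * entry (F k) i j =
      C ((directSum w).eigenHom D n i j) * scalarOP w n j := by
  rw [← entry_act_monicOP, ← hF, WeightMatrix.act_monicOP, entry_smul_monicOP]

/-! ### The diagonal second order operator -/

lemma coeff_secondOrder {A B p : ℂ[X]} (hA : A.natDegree ≤ 2) (hB : B.natDegree ≤ 1) {m : ℕ}
    (hp : p.natDegree ≤ m) : (derivative (derivative p) * A + derivative p * B).coeff m =
      ((m : ℂ) * (m - 1) * A.coeff 2 + m * B.coeff 1) * p.coeff m := by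
  have h1 : (derivative p).natDegree ≤ m - 1 := (natDegree_derivative_le p).trans (by omega)
  have h2 : (derivative (derivative p)).natDegree ≤ m - 2 :=
    (natDegree_derivative_le _).trans (by omega)
  rcases m with _ | _ | m
  · rw [eq_C_of_natDegree_le_zero hp]
    simp
  · have h3 : derivative (derivative p) = 0 := by
      rw [eq_C_of_natDegree_le_zero (show (derivative p).natDegree ≤ 0 from h1), derivative_C]
    have := coeff_mul_add_eq_of_natDegree_le h1 hB
    rw [h3, zero_mul, zero_add]
    simp only [Nat.zero_add, Nat.sub_self] at this ⊢
    rw [this, coeff_derivative]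
    push_cast
    ring
  · have e1 := coeff_mul_add_eq_of_natDegree_le h1 hB
    have e2 := coeff_mul_add_eq_of_natDegree_le h2 hA
    simp only [Nat.add_sub_cancel, show m + 1 + 1 - 2 = m by omega] at e1 e2
    rw [coeff_add, e1, show m + 1 + 1 = m + 2 from rfl, e2, coeff_derivative, coeff_derivative]
    push_cast
    ring

lemma ClassicalType.natDegree_leadCoeff_le (t : ClassicalType) : t.leadCoeff.natDegree ≤ 2 := by
  cases t <;> simp only [ClassicalType.leadCoeff] <;> compute_degree <;> norm_num

lemma ClassicalWeight.natDegree_driftCoeff_le (w : ClassicalWeight t) :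
    w.driftCoeff.natDegree ≤ 1 := by
  cases w <;> simp only [ClassicalWeight.driftCoeff] <;> compute_degree

/-- The eigenvalue of the second order operator on polynomials of degree `n`. -/
def ClassicalWeight.eigenvalue (w : ClassicalWeight t) (n : ℕ) : ℂ :=
  (n : ℂ) * (n - 1) * (t.leadCoeff.coeff 2 : ℝ) + n * (w.driftCoeff.coeff 1 : ℝ)

/-- The scalar operator `a ∂² + b ∂`. -/
def ClassicalWeight.secondOrder (w : ClassicalWeight t) (p : ℂ[X]) : ℂ[X] :=
  derivative (derivative p) * t.leadCoeff.map Complex.ofRealHom +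
    derivative p * w.driftCoeff.map Complex.ofRealHom

lemma ClassicalWeight.coeff_secondOrder (w : ClassicalWeight t) {p : ℂ[X]} {m : ℕ}
    (hp : p.natDegree ≤ m) : (w.secondOrder p).coeff m = w.eigenvalue m * p.coeff m := by
  rw [secondOrder, MatrixBochner.coeff_secondOrder
    (natDegree_map_le.trans t.natDegree_leadCoeff_le)
    (natDegree_map_le.trans w.natDegree_driftCoeff_le) hp, coeff_map, coeff_map]
  rfl

lemma ClassicalWeight.map_conj_secondOrder (w : ClassicalWeight t) (p : ℂ[X]) :
    (w.secondOrder p).map (starRingEnd ℂ) = w.secondOrder (p.map (starRingEnd ℂ)) := by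
  have h : ∀ q : ℝ[X], (q.map Complex.ofRealHom).map (starRingEnd ℂ) = q.map Complex.ofRealHom := by
    intro q
    ext k
    simp
  simp only [secondOrder, Polynomial.map_add, Polynomial.map_mul, h, derivative_map]

/-- The diagonal operator `diag (a ∂² + b_i ∂)`. -/
def diagSecondOrder : RightOp N :=
  monoOp 2 (diagPoly fun _ => t.leadCoeff.map Complex.ofRealHom) +
    monoOp 1 (diagPoly fun i => (w i).driftCoeff.map Complex.ofRealHom)

lemma entry_act_diagSecondOrder (P : MatPoly N) (i k : Fin N) :
    entry (act P (diagSecondOrder w)) i k = (w k).secondOrder (entry P i k) := by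
  rw [diagSecondOrder, act_add, act_monoOp, act_monoOp, entry_add, entry_mul_diagPoly,
    entry_mul_diagPoly, entry_iterate_derivative, entry_iterate_derivative]
  rfl

lemma diagSecondOrder_mem : diagSecondOrder w ∈ (directSum w).diffAlgebra := by
  have hdeg : IsDegreeNonraising (diagSecondOrder w) := by
    intro P
    rw [degree_le_iff_coeff_zero]
    intro m hm
    have hP : P.natDegree ≤ m := natDegree_le_iff_degree_le.2 hm.le
    ext r k
    rw [← coeff_entry, entry_act_diagSecondOrder,
      (w k).coeff_secondOrder (natDegree_entry_le hP r k), coeff_entry,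
      coeff_eq_zero_of_degree_lt hm, Matrix.zero_apply, mul_zero]
  refine (isAdjoint_of_entry w (fun k => (w k).secondOrder)
    (entry_act_diagSecondOrder w) fun k p q => ?_).mem_diffAlgebra
    ((isDiffOp_monoOp _ _).add (isDiffOp_monoOp _ _)) hdeg hdeg
  rw [(w k).map_conj_secondOrder]
  exact (w k).integral_secondOrder_symm p _

lemma eigenHom_diagSecondOrder (n : ℕ) :
    (directSum w).eigenHom ⟨diagSecondOrder w, diagSecondOrder_mem w⟩ n =
      Matrix.diagonal fun i => (w i).eigenvalue n := by
  ext r k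
  rw [WeightMatrix.eigenHom_apply, ← coeff_entry, entry_act_diagSecondOrder,
    (w k).coeff_secondOrder (natDegree_entry_le ((directSum w).natDegree_monicOP_le n) r k),
    coeff_entry, WeightMatrix.coeff_monicOP_self, Matrix.one_apply, Matrix.diagonal_apply]
  split_ifs with h
  · rw [h, mul_one]
  · rw [mul_zero]

/-- The differential equation of the scalar orthogonal polynomials. -/
lemma secondOrder_scalarOP (n : ℕ) (i : Fin N) :
    (w i).secondOrder (scalarOP w n i) = C ((w i).eigenvalue n) * scalarOP w n i := by
  have h := (directSum w).act_monicOP ⟨diagSecondOrder w, diagSecondOrder_mem w⟩ n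
  rw [eigenHom_diagSecondOrder] at h
  have h2 := congrArg (fun P => entry P i i) h
  simpa only [entry_act_diagSecondOrder, entry_diagonal_smul, scalarOP] using h2

end MatrixBochner

end

noncomputable section

namespace MatrixBochner

/-! ### Eigenvalues at a singular end point -/

section Endpoint

variable {A B : ℂ[X]}

lemma iterate_derivative_secondOrder (hA : A.natDegree ≤ 2) (hB : B.natDegree ≤ 1) {p : ℂ[X]}
    {μ : ℂ} (hp : derivative (derivative p) * A + derivative p * B = C μ * p) (k : ℕ) :
    derivative^[k + 2] p * A + derivative^[k + 1] p * (B + C (k : ℂ) * derivative A) +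
      derivative^[k] p * (C ((k : ℂ) * (k - 1) / 2) * derivative (derivative A) +
        C (k : ℂ) * derivative B) = C μ * derivative^[k] p := by
  have hA3 : derivative (derivative (derivative A)) = 0 := by
    rw [← Function.iterate_one derivative, ← Function.iterate_add_apply,
      ← Function.iterate_add_apply]
    exact iterate_derivative_eq_zero (by omega)
  have hB2 : derivative (derivative B) = 0 := by
    rw [← Function.iterate_one derivative, ← Function.iterate_add_apply]
    exact iterate_derivative_eq_zero (by omega)
  induction k with
  | zero => simpa using hp
  | succ k ih =>
    have h := congrArg derivative ih
    simp only [derivative_add, derivative_mul, derivative_C, hA3, hB2,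
      ← Function.iterate_succ_apply' derivative] at h
    have e : (C (((k + 1 : ℕ) : ℂ) * (((k + 1 : ℕ) : ℂ) - 1) / 2) : ℂ[X]) =
        C ((k : ℂ) * (k - 1) / 2) + C (k : ℂ) := by
      rw [← C_add]
      congr 1
      push_cast
      ring
    have e' : (C ((k + 1 : ℕ) : ℂ) : ℂ[X]) = C (k : ℂ) + 1 := by
      rw [← C_1, ← C_add]
      push_cast
      rfl
    rw [e, e']
    simp only [Nat.succ_eq_add_one] at h
    linear_combination h

/-- At a zero `x₀` of `A` where the exponents of the equation `A p'' + B p' = μ p` are not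
positive integers, the derivatives of a solution are fixed polynomials in `μ` times its value. -/
lemma exists_eval_iterate_derivative (hA : A.natDegree ≤ 2) (hB : B.natDegree ≤ 1) {x₀ : ℂ}
    (h0 : A.eval x₀ = 0) (hne : ∀ k : ℕ, B.eval x₀ + k * (derivative A).eval x₀ ≠ 0) :
    ∃ Q : ℕ → ℂ[X], ∀ (p : ℂ[X]) (μ : ℂ),
      derivative (derivative p) * A + derivative p * B = C μ * p →
        ∀ k, (derivative^[k] p).eval x₀ = (Q k).eval μ * p.eval x₀ := by
  let Q : ℕ → ℂ[X] := fun k => Nat.rec 1 (fun k q =>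
    C (B.eval x₀ + k * (derivative A).eval x₀)⁻¹ * (X - C ((k : ℂ) * (k - 1) / 2 *
      (derivative (derivative A)).eval x₀ + k * (derivative B).eval x₀)) * q) k
  refine ⟨Q, fun p μ hp k => ?_⟩
  induction k with
  | zero => simp [Q]
  | succ k ih =>
    have h := congrArg (eval x₀) (iterate_derivative_secondOrder hA hB hp k)
    simp only [eval_add, eval_mul, eval_C, h0, mul_zero, zero_add, ih] at h
    have hQ : (Q (k + 1)).eval μ = (B.eval x₀ + k * (derivative A).eval x₀)⁻¹ *
        (μ - ((k : ℂ) * (k - 1) / 2 * (derivative (derivative A)).eval x₀ +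
          k * (derivative B).eval x₀)) * (Q k).eval μ := by
      change (C _ * (X - C _) * Q k).eval μ = _
      simp only [eval_mul, eval_C, eval_sub, eval_X]
    rw [hQ]
    have hk := hne k
    field_simp
    linear_combination 2 * h

lemma eval_ne_zero_of_iterate_derivative {p : ℂ[X]} (hp : p ≠ 0) {x₀ : ℂ} {c : ℕ → ℂ}
    (h : ∀ k, (derivative^[k] p).eval x₀ = c k * p.eval x₀) : p.eval x₀ ≠ 0 := by
  intro h0
  refine hp (eq_zero_of_hasseDeriv_eq_zero p x₀ fun k => ?_)
  have h1 := h k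
  rw [h0, mul_zero, ← factorial_smul_hasseDeriv, LinearMap.smul_apply, eval_smul,
    nsmul_eq_mul] at h1
  exact (mul_eq_zero.1 h1).resolve_left (by exact_mod_cast k.factorial_ne_zero)

end Endpoint

variable {N : ℕ} {t : ClassicalType}

/-- Up to conjugation by a diagonal matrix, the entries of the eigenvalues of the operators in
`𝒟(w_1 ⊕ ⋯ ⊕ w_N)` are polynomials in the eigenvalues of the second order operators. -/
def HasPolynomialEigenvalues (w : Fin N → ClassicalWeight t) : Prop :=
  ∃ g : ℕ → Fin N → ℂ, (∀ n i, g n i ≠ 0) ∧ ∀ D : (directSum w).diffAlgebra,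
    ∃ R : Matrix (Fin N) (Fin N) ℂ[X], ∀ n i j,
      (directSum w).eigenHom D n i j * g n j = g n i * (R i j).eval ((w i).eigenvalue n)

lemma hasPolynomialEigenvalues_of_endpoint (w : Fin N → ClassicalWeight t) {x₀ : ℝ}
    (h0 : t.leadCoeff.eval x₀ = 0)
    (hne : ∀ i (k : ℕ), (w i).driftCoeff.eval x₀ + k * (derivative t.leadCoeff).eval x₀ ≠ 0) :
    HasPolynomialEigenvalues w := by
  have hev : ∀ q : ℝ[X], (q.map Complex.ofRealHom).eval (x₀ : ℂ) = (q.eval x₀ : ℝ) :=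
    fun q => eval_map_apply Complex.ofRealHom x₀
  have hQ := fun i => exists_eval_iterate_derivative (x₀ := (x₀ : ℂ))
    (natDegree_map_le.trans t.natDegree_leadCoeff_le)
    (natDegree_map_le.trans (w i).natDegree_driftCoeff_le) (by rw [hev, h0, Complex.ofReal_zero])
    (fun k => by
      rw [derivative_map, hev, hev]
      exact_mod_cast hne i k)
  choose Q hQ using hQ
  have hp := fun n i => hQ i (scalarOP w n i) _ (secondOrder_scalarOP w n i)
  refine ⟨fun n i => (scalarOP w n i).eval (x₀ : ℂ), fun n i =>
    eval_ne_zero_of_iterate_derivative (scalarOP_ne_zero w n i) (hp n i), fun D => ?_⟩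
  obtain ⟨m, F, hF⟩ := D.2.1
  refine ⟨Matrix.of fun i j => ∑ k ∈ Finset.range (m + 1),
    C ((entry (F k) i j).eval (x₀ : ℂ)) * Q i k, fun n i j => ?_⟩
  have h := congrArg (eval (x₀ : ℂ)) (sum_iterate_derivative_scalarOP w D hF n i j)
  rw [eval_mul, eval_C, eval_finsetSum] at h
  rw [← h, Matrix.of_apply, eval_finsetSum, Finset.mul_sum]
  refine Finset.sum_congr rfl fun k _ => ?_
  rw [eval_mul, eval_mul, eval_C, hp]
  ring

/-! ### Eigenvalues from leading coefficients -/

section LeadingCoefficients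

lemma coeff_iterate_derivative_mul {p f : ℂ[X]} {n k : ℕ} (hp : p.natDegree ≤ n)
    (hf : f.natDegree ≤ k) : (derivative^[k] p * f).coeff n =
      (n.descFactorial k : ℂ) * p.coeff n * f.coeff k := by
  by_cases hk : k ≤ n
  · obtain ⟨m, rfl⟩ := Nat.exists_eq_add_of_le' hk
    have h1 : (derivative^[k] p).natDegree ≤ m :=
      (natDegree_iterate_derivative p k).trans (by omega)
    rw [coeff_mul_add_eq_of_natDegree_le h1 hf, coeff_iterate_derivative, nsmul_eq_mul]
  · rw [iterate_derivative_eq_zero (by omega), zero_mul, coeff_zero,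
      Nat.descFactorial_eq_zero_iff_lt.2 (by omega)]
    simp

variable (w : Fin N → ClassicalWeight t)

lemma natDegree_entry_coeff_le (D : (directSum w).diffAlgebra) {m : ℕ} {F : ℕ → MatPoly N}
    (hF : (D : RightOp N) = diffOp m F) {k : ℕ} (hk : k ≤ m) (i j : Fin N) :
    (entry (F k) i j).natDegree ≤ k := by
  induction k using Nat.strong_induction_on with
  | _ k ih =>
  have h := sum_iterate_derivative_scalarOP w D hF k i j
  have hz : ∀ l ∈ Finset.range (m + 1), l ∉ Finset.range (k + 1) →
      derivative^[l] (scalarOP w k i) * entry (F l) i j = 0 := by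
    intro l _ hl
    have hl : k < l := by simpa using hl
    rw [iterate_derivative_eq_zero ((natDegree_scalarOP_le w k i).trans_lt hl), zero_mul]
  rw [← Finset.sum_subset (Finset.range_mono (Nat.succ_le_succ hk)) hz,
    Finset.sum_range_succ] at h
  have hlead : derivative^[k] (scalarOP w k i) = C (k.factorial : ℂ) := by
    have h1 : (derivative^[k] (scalarOP w k i)).natDegree ≤ 0 :=
      (natDegree_iterate_derivative _ k).trans
        (by have := natDegree_scalarOP_le w k i; omega)
    rw [eq_C_of_natDegree_le_zero h1, coeff_iterate_derivative, zero_add, coeff_scalarOP_self,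
      Nat.descFactorial_self, nsmul_eq_mul, mul_one]
  rw [hlead] at h
  have h2 : C (k.factorial : ℂ) * entry (F k) i j =
      C ((directSum w).eigenHom D k i j) * scalarOP w k j -
        ∑ l ∈ Finset.range k, derivative^[l] (scalarOP w k i) * entry (F l) i j := by
    rw [← h]
    ring
  have h3 : (C (k.factorial : ℂ) * entry (F k) i j).natDegree ≤ k := by
    rw [h2]
    refine (natDegree_sub_le_of_le (n := k) ((natDegree_C_mul_le _ _).trans (natDegree_scalarOP_le w k j))
      (natDegree_sum_le_of_forall_le _ _ fun l hl => ?_)).trans (max_self k).le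
    have hl : l < k := Finset.mem_range.1 hl
    refine (natDegree_mul_le_of_le (natDegree_iterate_derivative _ l)
      (ih l hl (hl.le.trans hk))).trans ?_
    have := natDegree_scalarOP_le w k i
    omega
  rwa [natDegree_C_mul (by exact_mod_cast k.factorial_ne_zero)] at h3

lemma hasPolynomialEigenvalues_of_eigenvalue_eq (h : ∀ i n, (w i).eigenvalue n = n) :
    HasPolynomialEigenvalues w := by
  refine ⟨fun _ _ => 1, fun _ _ => one_ne_zero, fun D => ?_⟩
  obtain ⟨m, F, hF⟩ := D.2.1
  refine ⟨Matrix.of fun i j => ∑ k ∈ Finset.range (m + 1),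
    C ((entry (F k) i j).coeff k) * descPochhammer ℂ k, fun n i j => ?_⟩
  have hc := congrArg (fun p => p.coeff n) (sum_iterate_derivative_scalarOP w D hF n i j)
  simp only [coeff_C_mul, coeff_scalarOP_self, finsetSum_coeff] at hc
  rw [← hc, one_mul, Matrix.of_apply, eval_finsetSum]
  refine Finset.sum_congr rfl fun k hk => ?_
  rw [coeff_iterate_derivative_mul (natDegree_scalarOP_le w n i) (natDegree_entry_coeff_le w D hF
    (Nat.lt_succ_iff.1 (Finset.mem_range.1 hk)) i j), coeff_scalarOP_self, h, eval_mul, eval_C,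
    descPochhammer_eval_eq_descFactorial]
  ring

end LeadingCoefficients

lemma ClassicalWeight.eigenvalue_hermite (w : ClassicalWeight .hermite) (n : ℕ) :
    w.eigenvalue n = n := by
  cases w
  simp [eigenvalue, ClassicalType.leadCoeff, driftCoeff, coeff_X]

lemma ClassicalWeight.eigenvalue_laguerre (w : ClassicalWeight .laguerre) (n : ℕ) :
    w.eigenvalue n = n := by
  cases w
  simp [eigenvalue, ClassicalType.leadCoeff, driftCoeff, coeff_X, coeff_one]

lemma ClassicalWeight.exists_eigenvalue_jacobi (w : ClassicalWeight .jacobi) :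
    ∃ s : ℂ, ∀ n : ℕ, w.eigenvalue n = n * (n + s) := by
  cases w with
  | jacobi α β hα hβ =>
    refine ⟨α + β + 1, fun n => ?_⟩
    have h1 : (X ^ 2 - 1 : ℝ[X]).coeff 2 = 1 := by simp [coeff_one]
    have h2 : (C (α + β + 2) * X + C (α - β) : ℝ[X]).coeff 1 = α + β + 2 := by simp [coeff_C]
    rw [eigenvalue, ClassicalType.leadCoeff, driftCoeff, h1, h2]
    push_cast
    ring

theorem hasPolynomialEigenvalues (w : Fin N → ClassicalWeight t) : HasPolynomialEigenvalues w := by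
  cases t with
  | hermite => exact hasPolynomialEigenvalues_of_eigenvalue_eq w fun i => (w i).eigenvalue_hermite
  | laguerre => exact hasPolynomialEigenvalues_of_eigenvalue_eq w fun i => (w i).eigenvalue_laguerre
  | jacobi =>
    refine hasPolynomialEigenvalues_of_endpoint w (x₀ := 1) (by simp [ClassicalType.leadCoeff])
      fun i k => ?_
    cases w i with
    | jacobi α β hα hβ =>
      have hk : (0 : ℝ) ≤ k := k.cast_nonneg
      simp only [ClassicalWeight.driftCoeff, ClassicalType.leadCoeff, eval_add, eval_mul, eval_C,
        eval_X, derivative_sub, derivative_X_pow, derivative_one, eval_sub, eval_pow, eval_zero]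
      refine ne_of_gt ?_
      norm_num
      linarith

/-! ### Coupled weights have the same eigenvalues -/

lemma eq_of_quadratic_eigenvalues {q₁ q₂ : ℂ[X]} {a b : ℂ}
    (h : ∀ n : ℕ, q₁.eval ((n : ℂ) * (n + a)) * (n * (n + b)) = q₂.eval ((n : ℂ) * (n + a)))
    {n₀ : ℕ} (hne : q₁.eval ((n₀ : ℂ) * (n₀ + a)) ≠ 0) : a = b := by
  have hpoly : q₁.comp (X * (X + C a)) * (X * (X + C b)) = q₂.comp (X * (X + C a)) := by
    refine eq_of_infinite_eval_eq _ _ ((Set.infinite_range_of_injective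
      (f := fun n : ℕ => (n : ℂ)) Nat.cast_injective).mono ?_)
    rintro _ ⟨n, rfl⟩
    simpa [eval_comp] using h n
  have hσ : ((X * (X + C a)).comp (-X - C a) : ℂ[X]) = X * (X + C a) := by
    simp
    ring
  have h2 := congrArg (fun p => p.comp (-X - C a)) hpoly
  rw [mul_comp, comp_assoc, comp_assoc, hσ, ← hpoly] at h2
  have hq : q₁.comp (X * (X + C a)) ≠ 0 := by
    intro h0
    have := congrArg (eval (n₀ : ℂ)) h0
    exact hne (by simpa [eval_comp] using this)
  have h3 := mul_left_cancel₀ hq h2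
  have e0 := congrArg (eval 0) h3
  have e1 := congrArg (eval 1) h3
  simp only [eval_comp, eval_mul, eval_add, eval_sub, eval_neg, eval_X, eval_C] at e0 e1
  linear_combination (e1 - e0) / 2

end MatrixBochner

end

noncomputable section

namespace MatrixBochner

variable {N : ℕ} {t : ClassicalType} (w : Fin N → ClassicalWeight t)

lemma form_monicOP_directSum_of_ne (n : ℕ) {i j : Fin N} (h : i ≠ j) :
    (directSum w).form ((directSum w).monicOP n) ((directSum w).monicOP n) i j = 0 := by
  rw [form_directSum]
  refine Finset.sum_eq_zero fun k _ => ?_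
  by_cases hk : i = k
  · rw [entry_monicOP_of_ne w (fun hj : j = k => h (hk.trans hj.symm))]
    simp
  · rw [entry_monicOP_of_ne w hk]
    simp

lemma form_monicOP_directSum_self_ne_zero (n : ℕ) (i : Fin N) :
    (directSum w).form ((directSum w).monicOP n) ((directSum w).monicOP n) i i ≠ 0 := by
  intro h0
  have hunit := (Matrix.isUnit_iff_isUnit_det _).1 ((directSum w).isUnit_form_monicOP n)
  refine hunit.ne_zero (Matrix.det_eq_zero_of_row_eq_zero i fun j => ?_)
  by_cases hij : i = j
  · rw [← hij, h0]
  · exact form_monicOP_directSum_of_ne w n hij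

/-- An operator with a nonzero `(i, j)` eigenvalue has an adjoint with a nonzero `(j, i)`
eigenvalue. -/
lemma exists_reverse (D : (directSum w).diffAlgebra) : ∃ D' : (directSum w).diffAlgebra,
    ∀ n i j, (directSum w).eigenHom D n i j ≠ 0 → (directSum w).eigenHom D' n j i ≠ 0 := by
  obtain ⟨D', hD'⟩ := (directSum w).exists_adjoint D
  refine ⟨D', fun n i j hij h0 => ?_⟩
  have h := congrFun (congrFun (hD' n) j) i
  rw [Matrix.mul_apply, Matrix.mul_apply, Finset.sum_eq_single i, Finset.sum_eq_single j, h0,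
    zero_mul, Matrix.conjTranspose_apply] at h
  · exact mul_ne_zero (form_monicOP_directSum_self_ne_zero w n j) (star_ne_zero.2 hij) h.symm
  · intro k _ hk
    rw [form_monicOP_directSum_of_ne w n hk.symm, zero_mul]
  · simp
  · intro k _ hk
    rw [form_monicOP_directSum_of_ne w n hk, mul_zero]
  · simp

lemma mul_diagonal_single_mul_apply (A B : Mat N) (c : Fin N → ℂ) (i j : Fin N) :
    (A * (Matrix.diagonal (Pi.single j 1) : Mat N) * (Matrix.diagonal c : Mat N) * B : Mat N) i i = A i j * c j * B j i := by
  rw [Matrix.mul_apply, Finset.sum_eq_single j]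
  · rw [Matrix.mul_diagonal, Matrix.mul_diagonal, Pi.single_eq_same, mul_one]
  · intro k _ hk
    rw [Matrix.mul_diagonal, Matrix.mul_diagonal, Pi.single_eq_of_ne hk, mul_zero, zero_mul,
      zero_mul]
  · simp

lemma eigenvalue_eq_of_jacobi (w : Fin N → ClassicalWeight .jacobi)
    (D : (directSum w).diffAlgebra) {n₀ : ℕ} {i j : Fin N}
    (hij : (directSum w).eigenHom D n₀ i j ≠ 0) : (w i).eigenvalue = (w j).eigenvalue := by
  obtain ⟨D', hD'⟩ := exists_reverse w D
  obtain ⟨g, hg, hR⟩ := hasPolynomialEigenvalues w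
  have hdiag : ∀ D₁ : (directSum w).diffAlgebra, ∃ q : ℂ[X], ∀ n,
      (directSum w).eigenHom D₁ n i i = q.eval ((w i).eigenvalue n) := by
    intro D₁
    obtain ⟨R, hR⟩ := hR D₁
    refine ⟨R i i, fun n => mul_right_cancel₀ (hg n i) ?_⟩
    rw [hR, mul_comm]
  let e : (directSum w).diffAlgebra := ⟨coordProj j, coordProj_mem w j⟩
  let Δ : (directSum w).diffAlgebra := ⟨diagSecondOrder w, diagSecondOrder_mem w⟩
  have h₁ : ∀ n, (directSum w).eigenHom (D * e * 1 * D') n i i =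
      (directSum w).eigenHom D n i j * 1 * (directSum w).eigenHom D' n j i := by
    intro n
    rw [map_mul, map_mul, map_mul, map_one, Pi.mul_apply, Pi.mul_apply, Pi.mul_apply, Pi.one_apply,
      eigenHom_coordProj, ← Matrix.diagonal_one, mul_diagonal_single_mul_apply]
  have h₂ : ∀ n, (directSum w).eigenHom (D * e * Δ * D') n i i =
      (directSum w).eigenHom D n i j * (w j).eigenvalue n * (directSum w).eigenHom D' n j i := by
    intro n
    rw [map_mul, map_mul, map_mul, Pi.mul_apply, Pi.mul_apply, Pi.mul_apply,
      eigenHom_coordProj, eigenHom_diagSecondOrder, mul_diagonal_single_mul_apply]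
  obtain ⟨q₁, hq₁⟩ := hdiag (D * e * 1 * D')
  obtain ⟨q₂, hq₂⟩ := hdiag (D * e * Δ * D')
  obtain ⟨a, ha⟩ := (w i).exists_eigenvalue_jacobi
  obtain ⟨b, hb⟩ := (w j).exists_eigenvalue_jacobi
  have hab : a = b := by
    refine eq_of_quadratic_eigenvalues (q₁ := q₁) (q₂ := q₂) (n₀ := n₀) (fun n => ?_) ?_
    · rw [← ha, ← hb, ← hq₁, ← hq₂, h₁, h₂]
      ring
    · rw [← ha, ← hq₁, h₁, mul_one]
      exact mul_ne_zero hij (hD' n₀ i j hij)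
  funext n
  rw [ha, hb, hab]

lemma eigenvalue_eq_of_eigenHom_ne_zero (D : (directSum w).diffAlgebra) (n : ℕ) (i j : Fin N)
    (hij : (directSum w).eigenHom D n i j ≠ 0) : (w i).eigenvalue = (w j).eigenvalue := by
  cases t with
  | hermite => funext n; rw [(w i).eigenvalue_hermite, (w j).eigenvalue_hermite]
  | laguerre => funext n; rw [(w i).eigenvalue_laguerre, (w j).eigenvalue_laguerre]
  | jacobi => exact eigenvalue_eq_of_jacobi w D hij

/-- Every operator in `𝒟(w_1 ⊕ ⋯ ⊕ w_N)` with invertible eigenvalues divides a central one. -/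
theorem exists_mul_mem_center_directSum (D : (directSum w).diffAlgebra)
    (hD : ∀ n, IsUnit ((directSum w).eigenHom D n)) : ∃ E : (directSum w).diffAlgebra,
      D * E ∈ Subalgebra.center ℂ (directSum w).diffAlgebra ∧
        ∀ n, IsUnit ((directSum w).eigenHom E n) := by
  obtain ⟨g, hg, hR⟩ := hasPolynomialEigenvalues w
  exact exists_mul_mem_center (φ := (directSum w).eigenHom) (μ := fun i => (w i).eigenvalue)
    (e := fun i => ⟨coordProj i, coordProj_mem w i⟩)
    (directSum w).eigenHom_injective (eigenHom_diagSecondOrder w) (eigenHom_coordProj w)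
    (eigenvalue_eq_of_eigenHom_ne_zero w) hg D (hR D) hD

end MatrixBochner

end

open MatrixBochner
theorem theorem4p2 {N : ℕ} {t : ClassicalType} (w : Fin N → ClassicalWeight t)
    (W : WeightMatrix N t.support) (hW : W.DarbouxEquivalent (directSum w)) :
    ∃ D ∈ Subalgebra.center ℂ (directSum w).diffAlgebra, ∃ V N' : matDiffOps N,
      WeightMatrix.IsDarbouxFactorization (directSum w) W D V N' := by
  obtain ⟨D, V, M, h⟩ := hW.isDarbouxTransformation.symm
  have hdp : IsDegreePreserving (D : RightOp N) := fun P => by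
    rw [h.factor, act_mul, h.degreePreserving_right, h.degreePreserving_left]
  obtain ⟨E, hE, hunit⟩ := exists_mul_mem_center_directSum w D fun n =>
    (directSum w).isUnit_of_isDegreePreserving hdp ((directSum w).act_monicOP D n)
  refine ⟨D * E, hE, V, M * ⟨E, E.2.1⟩, ?_, h.degreePreserving_left, fun P => ?_, h.intertwines⟩
  · rw [Subalgebra.coe_mul, Subalgebra.coe_mul, h.factor, mul_assoc]
  · rw [Subalgebra.coe_mul, act_mul, (directSum w).isDegreePreserving_of_isUnit
      ((directSum w).act_monicOP E) hunit, h.degreePreserving_right]
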